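/- **Setting.** Let $\mathbb H$ be a separable complex Hilbert space with inner product $\langle\cdot,\cdot\rangle$ linear in the first argument and with a fixed orthonormal basis $\{e_j\}$. Put $\overline{x}=\sum_j\overline{\langle x,e_j\rangle}e_j$, call $x$ real if $\overline x=x$, and let $(x\otimes y)(z)=\langle z,y\rangle x$. Write $\|A\|_{\rm tr}=\sum_j\langle (A^*A)^{1/2}e_j,e_j\rangle$ and $\|A\|_{\rm HS}=\|A^*A\|_{\rm tr}^{1/2}$, and let $\langle\cdot,\cdot\rangle_{\rm HS}$ be the Hilbert–Schmidt inner product. Let $|A|$ be the Lebesgue measure of $A\subset\mathbb R^d$, $d\ge 1$, and let $B(0,\delta)$ be the ball of radius $\delta$ about $0$. Let $X=\{X(t),\,t\in\mathbb R^d\}$ be a real (almost surely $X(t)=\overline{X(t)}$ for each $t$), mean-zero, second-order stationary $\mathbb H$-valued process: $\mathbb E\|X(t)\|^2<\infty$, and $\mathbb E[X(t)\otimes X(s)]$ and $\mathbb E[X(t)\otimes\overline{X(s)}]$ depend only on $t-s$. Put $C(h)=\mathbb E[X(h)\otimes X(0)]$. **Assumption C.** (a) $\int_{\mathbb R^d}\|C(h)\|_{\rm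 tr}\,dh<\infty$ (with $h\mapsto\|C(h)\|_{\rm tr}$ Lebesgue measurable). (b) For some $0<\gamma\le1$, $M<\infty$ and $\delta_0>0$, $$\int_{\mathbb R^d}\ \sup_{y:\|x-y\|\le\delta}\|C(y)-C(x)\|_{\rm tr}\,dx\le M\delta^\gamma\qquad\text{for all }0<\delta\le\delta_0 .$$ **Assumption K.** $K:\mathbb R^d\to[0,\infty)$ is continuous, $S_K=\{K>0\}$ is bounded, $\sup K=K(0)=1$, and $K$ is differentiable with bounded gradient in a neighbourhood of $0$. **Assumption S.** For each $n$ let $\mathbb T_n\subset\mathbb R^d$ be a finite set with convex hull $T_n$, let $V(t)=\{x\in T_n:\|x-t\|\le\|x-s\|\ \forall s\in\mathbb T_n\}$ $(t\in\mathbb T_n)$ be its Voronoi cells, and let $\delta_n=\max_{t\in\mathbb T_n}\sup_{x\in V(t)}\|x-t\|$. Then (a) $\delta_n\to0$ and $|T_n|\to\infty$; (b) $T_n/|T_n|^{1/d}$ converges in the Hausdorff metric to a fixed bounded convex set with non-empty interior. **Assumption V.** (a) $\mathbb E\|X(t)\|^4<\infty$ for all $t$. With $$\begin{aligned}{\rm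 cum}(Y_1,Y_2,Y_3,Y_4)={}&\mathbb E\langle Y_1\otimes Y_2,Y_3\otimes Y_4\rangle_{\rm HS}-\langle\mathbb E(Y_1\otimes Y_2),\mathbb E(Y_3\otimes Y_4)\rangle_{\rm HS}\\&-\mathbb E\langle Y_1,Y_3\rangle\,\mathbb E\langle Y_4,Y_2\rangle-\langle\mathbb E(Y_1\otimes\overline{Y_4}),\mathbb E(Y_3\otimes\overline{Y_2})\rangle_{\rm HS},\end{aligned}$$ (b) ${\rm cum}(X(t+\tau),X(s+\tau),X(w+\tau),X(v+\tau))={\rm cum}(X(t),X(s),X(w),X(v))$ for all $t,s,w,v,\tau$; (c) for some $\delta>0$, $$\sup_{w}\int\!\!\int\sup_{\lambda_1,\lambda_2,\lambda_3\in B(0,\delta)}\big|{\rm cum}(X(\lambda_1+u),X(\lambda_2+v),X(\lambda_3+w),X(0))\big|\,dv\,du<\infty .$$ **Estimator.** For bandwidths $\Delta_n>0$ let $$\hat f_n(\theta)=\frac1{(2\pi)^d}\sum_{t,s\in\mathbb T_n}e^{\mathrm i(t-s)^\top\theta}\,\frac{X(t)\otimes X(s)}{|T_n\cap(T_n-(t-s))|}\,K\!\Big(\frac{t-s}{\Delta_n}\Big)|V(t)|\,|V(s)|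 ,$$ where terms with $K((t-s)/\Delta_n)=0$ are $0$. **Theorem.** Let Assumptions C, K, S and V hold. Suppose that $\Delta_n S_K\subset T_n-T_n$ for all large $n$, that $\delta_n=\mathcal O(\Delta_n)$ (in particular this holds if $\Delta_n\to\infty$), and that $\Delta_n^d/|T_n|\to0$. Then for every set $\Theta\subset\mathbb R^d$ $$\sup_{\theta\in\Theta}\mathbb E\big\|\hat f_n(\theta)-\mathbb E\hat f_n(\theta)\big\|_{\rm HS}^2=\mathcal O\Big(\frac{\Delta_n^d}{|T_n|}\Big)\qquad(n\to\infty).$$ -/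

import Mathlib

open MeasureTheory Filter Topology
open scoped ENNReal Pointwise

namespace SpectralVar

section Operators

/-- The outer product `x ⊗ y : z ↦ ⟨z, y⟩ x`, where `⟨z, y⟩` is linear in `z`
(Mathlib's `inner ℂ y z`). -/
noncomputable def outer {H : Type*} [NormedAddCommGroup H] [InnerProductSpace ℂ H]
    (x y : H) : H →L[ℂ] H :=
  InnerProductSpace.rankOne ℂ x y

/-- Complex conjugation on `H` with respect to the designated real orthonormal basis `e`:
`∑ ⟨x, e j⟩ e j ↦ ∑ conj ⟨x, e j⟩ e j`. -/
noncomputable def conjH {H ι : Type*} [NormedAddCommGroup H] [InnerProductSpace ℂ H]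
    (e : HilbertBasis ι ℂ H) (x : H) : H :=
  e.repr.symm (star (e.repr x))

/-- The trace norm `∑ j, ⟨(A* A)^{1/2} e j, e j⟩`, with value `∞` if `A` is not trace class.
It does not depend on the orthonormal basis `e`. -/
noncomputable def traceNorm {H ι : Type*} [NormedAddCommGroup H] [InnerProductSpace ℂ H]
    [CompleteSpace H] (e : HilbertBasis ι ℂ H) (A : H →L[ℂ] H) : ℝ≥0∞ :=
  ∑' j, ENNReal.ofReal (inner ℂ (e j) (CFC.abs A (e j))).re

/-- The Hilbert-Schmidt norm `‖A* A‖_tr ^ (1/2)`, with value `∞` if `A` is not Hilbert-Schmidt. -/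
noncomputable def hsNorm {H ι : Type*} [NormedAddCommGroup H] [InnerProductSpace ℂ H]
    [CompleteSpace H] (e : HilbertBasis ι ℂ H) (A : H →L[ℂ] H) : ℝ≥0∞ :=
  traceNorm e (A.adjoint ∘L A) ^ (1 / 2 : ℝ)

/-- The Hilbert-Schmidt inner product `trace (A* B)`. -/
noncomputable def hsInner {H ι : Type*} [NormedAddCommGroup H] [InnerProductSpace ℂ H]
    [CompleteSpace H] (e : HilbertBasis ι ℂ H) (A B : H →L[ℂ] H) : ℂ :=
  ∑' j, inner ℂ (e j) ((A.adjoint ∘L B) (e j))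

end Operators

section RandomElements

/-- The cross-covariance operator `E (Y ⊗ Z)` of two square integrable mean-zero random elements. -/
noncomputable def crossCov {Ω H : Type*} [MeasurableSpace Ω] [NormedAddCommGroup H]
    [InnerProductSpace ℂ H] (P : Measure Ω) (Y Z : Ω → H) : H →L[ℂ] H :=
  ∫ ω, outer (Y ω) (Z ω) ∂P

/-- The fourth-order cumulant of mean-zero random elements of `H`.  All inner products are
conjugate-linear in the first argument; with the opposite convention the value is replaced by its
complex conjugate (for real random elements all terms are real). -/
noncomputable def cum {Ω H ι : Type*} [MeasurableSpace Ω] [NormedAddCommGroup H]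
    [InnerProductSpace ℂ H] [CompleteSpace H] (P : Measure Ω) (e : HilbertBasis ι ℂ H)
    (Y₁ Y₂ Y₃ Y₄ : Ω → H) : ℂ :=
  (∫ ω, hsInner e (outer (Y₁ ω) (Y₂ ω)) (outer (Y₃ ω) (Y₄ ω)) ∂P)
    - hsInner e (crossCov P Y₁ Y₂) (crossCov P Y₃ Y₄)
    - (∫ ω, inner ℂ (Y₁ ω) (Y₃ ω) ∂P) * (∫ ω, inner ℂ (Y₄ ω) (Y₂ ω) ∂P)
    - hsInner e (crossCov P Y₁ (fun ω => conjH e (Y₄ ω)))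
        (crossCov P Y₃ (fun ω => conjH e (Y₂ ω)))

/-- A process is real if it takes values in the real elements of `H`. -/
def IsRealProcess {Ω H ι : Type*} [MeasurableSpace Ω] [NormedAddCommGroup H]
    [InnerProductSpace ℂ H] {d : ℕ} (P : Measure Ω) (e : HilbertBasis ι ℂ H)
    (X : EuclideanSpace ℝ (Fin d) → Ω → H) : Prop :=
  ∀ t, ∀ᵐ ω ∂P, conjH e (X t ω) = X t ω

/-- A mean-zero, second-order stationary process: finite second moments, and both the covariance
operator and the pseudo-covariance operator depend only on the lag. -/
structure IsSecondOrderStationary {Ω H ι : Type*} [MeasurableSpace Ω] [NormedAddCommGroup H]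
    [InnerProductSpace ℂ H] {d : ℕ} (P : Measure Ω) (e : HilbertBasis ι ℂ H)
    (X : EuclideanSpace ℝ (Fin d) → Ω → H) : Prop where
  memLp_two : ∀ t, MemLp (X t) 2 P
  mean_zero : ∀ t, ∫ ω, X t ω ∂P = 0
  cov_shift : ∀ t s τ, crossCov P (X (t + τ)) (X (s + τ)) = crossCov P (X t) (X s)
  pseudoCov_shift : ∀ t s τ,
    crossCov P (X (t + τ)) (fun ω => conjH e (X (s + τ) ω)) =
      crossCov P (X t) (fun ω => conjH e (X s ω))

/-- The stationary covariance operator `C(h) = E (X(h) ⊗ X(0))`. -/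
noncomputable def statCov {Ω H : Type*} [MeasurableSpace Ω] [NormedAddCommGroup H]
    [InnerProductSpace ℂ H] {d : ℕ} (P : Measure Ω)
    (X : EuclideanSpace ℝ (Fin d) → Ω → H) (h : EuclideanSpace ℝ (Fin d)) : H →L[ℂ] H :=
  crossCov P (X h) (X 0)

/-- Conditions on an operator-valued covariance function: it is integrable in trace norm and
`L¹`-`γ`-Hölder for some `0 < γ ≤ 1`. -/
structure CovarianceCondition {H ι : Type*} [NormedAddCommGroup H] [InnerProductSpace ℂ H]
    [CompleteSpace H] {d : ℕ} (e : HilbertBasis ι ℂ H)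
    (C : EuclideanSpace ℝ (Fin d) → H →L[ℂ] H) : Prop where
  aemeasurable : AEMeasurable (fun h => traceNorm e (C h)) volume
  integrable : ∫⁻ h, traceNorm e (C h) < ∞
  holder : ∃ γ : ℝ, 0 < γ ∧ γ ≤ 1 ∧ ∃ M : ℝ, ∃ δ₀ > (0 : ℝ), ∀ δ : ℝ, 0 < δ → δ ≤ δ₀ →
    ∫⁻ x, (⨆ y, ⨆ (_ : ‖x - y‖ ≤ δ), traceNorm e (C y - C x)) ≤ ENNReal.ofReal (M * δ ^ γ)

/-- Fourth-order conditions on the process: finite fourth moments, stationarity of the fourth-order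
cumulants, and their integrability. -/
structure CumulantCondition {Ω H ι : Type*} [MeasurableSpace Ω] [NormedAddCommGroup H]
    [InnerProductSpace ℂ H] [CompleteSpace H] {d : ℕ} (P : Measure Ω) (e : HilbertBasis ι ℂ H)
    (X : EuclideanSpace ℝ (Fin d) → Ω → H) : Prop where
  memLp_four : ∀ t, MemLp (X t) 4 P
  cum_shift : ∀ t s w v τ,
    cum P e (X (t + τ)) (X (s + τ)) (X (w + τ)) (X (v + τ)) = cum P e (X t) (X s) (X w) (X v)
  cum_integrable : ∃ δ > (0 : ℝ),
    (⨆ w : EuclideanSpace ℝ (Fin d),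
      ∫⁻ u : EuclideanSpace ℝ (Fin d), ∫⁻ v : EuclideanSpace ℝ (Fin d),
        ⨆ l₁ ∈ Metric.ball (0 : EuclideanSpace ℝ (Fin d)) δ,
        ⨆ l₂ ∈ Metric.ball (0 : EuclideanSpace ℝ (Fin d)) δ,
        ⨆ l₃ ∈ Metric.ball (0 : EuclideanSpace ℝ (Fin d)) δ,
          ‖cum P e (X (l₁ + u)) (X (l₂ + v)) (X (l₃ + w)) (X 0)‖ₑ) < ∞

end RandomElements

section Sampling

/-- The sampling region: the (closed) convex hull of the finite set of sampling points. -/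
def region {d : ℕ} (𝕋 : Finset (EuclideanSpace ℝ (Fin d))) : Set (EuclideanSpace ℝ (Fin d)) :=
  convexHull ℝ (𝕋 : Set (EuclideanSpace ℝ (Fin d)))

/-- The Voronoi cell, within the sampling region, of the sampling point `t`. -/
def cell {d : ℕ} (𝕋 : Finset (EuclideanSpace ℝ (Fin d))) (t : EuclideanSpace ℝ (Fin d)) :
    Set (EuclideanSpace ℝ (Fin d)) :=
  {x | x ∈ region 𝕋 ∧ ∀ s ∈ 𝕋, dist x t ≤ dist x s}

/-- The diameter of the Voronoi tessellation: the largest distance from a sampling point to a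
point of its cell. -/
noncomputable def mesh {d : ℕ} (𝕋 : Finset (EuclideanSpace ℝ (Fin d))) : ℝ≥0∞ :=
  ⨆ t ∈ 𝕋, ⨆ x ∈ cell 𝕋 t, edist x t

/-- Mixed-domain sampling: the mesh tends to zero, the volume of the sampling region tends to
infinity, and the rescaled region converges in the Hausdorff metric to a bounded convex set with
non-empty interior. -/
structure SamplingCondition {d : ℕ} (𝕋 : ℕ → Finset (EuclideanSpace ℝ (Fin d))) : Prop where
  mesh_tendsto : Tendsto (fun n => mesh (𝕋 n)) atTop (𝓝 0)
  volume_tendsto : Tendsto (fun n => volume.real (region (𝕋 n))) atTop atTop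
  shape : ∃ T : Set (EuclideanSpace ℝ (Fin d)),
    Bornology.IsBounded T ∧ Convex ℝ T ∧ (interior T).Nonempty ∧
    Tendsto (fun n => Metric.hausdorffEDist
      (((volume.real (region (𝕋 n)) ^ (1 / (d : ℝ)))⁻¹ : ℝ) • region (𝕋 n)) T) atTop (𝓝 0)

/-- The set on which the kernel is positive. -/
def kernelSupport {d : ℕ} (K : EuclideanSpace ℝ (Fin d) → ℝ) : Set (EuclideanSpace ℝ (Fin d)) :=
  {u | 0 < K u}

/-- Conditions on the kernel. -/
structure KernelCondition {d : ℕ} (K : EuclideanSpace ℝ (Fin d) → ℝ) : Prop where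
  continuous : Continuous K
  nonneg : ∀ u, 0 ≤ K u
  support_bounded : Bornology.IsBounded (kernelSupport K)
  le_one : ∀ u, K u ≤ 1
  at_zero : K 0 = 1
  gradient_bounded : ∃ ε > (0 : ℝ), ∃ M : ℝ, ∀ u, ‖u‖ < ε →
    DifferentiableAt ℝ K u ∧ ‖gradient K u‖ ≤ M

/-- The spectral density estimator `f̂(θ)` based on the observations `X t`, `t ∈ 𝕋`, with kernel `K`
and bandwidth `Δ`.  The set `(fun x => x - h) '' T` is the translate `T - h`. -/
noncomputable def estimator {Ω H : Type*} [NormedAddCommGroup H] [InnerProductSpace ℂ H] {d : ℕ}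
    (X : EuclideanSpace ℝ (Fin d) → Ω → H) (K : EuclideanSpace ℝ (Fin d) → ℝ)
    (𝕋 : Finset (EuclideanSpace ℝ (Fin d))) (Δ : ℝ) (θ : EuclideanSpace ℝ (Fin d)) (ω : Ω) :
    H →L[ℂ] H :=
  ((1 / (2 * Real.pi) ^ d : ℝ) : ℂ) • ∑ t ∈ 𝕋, ∑ s ∈ 𝕋,
    (Complex.exp (Complex.I * ((inner ℝ (t - s) θ : ℝ) : ℂ)) *
      ((K (Δ⁻¹ • (t - s)) * volume.real (cell 𝕋 t) * volume.real (cell 𝕋 s) /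
        volume.real (region 𝕋 ∩ (fun x => x - (t - s)) '' region 𝕋) : ℝ) : ℂ)) •
      outer (X t ω) (X s ω)

/-- The variance `E ‖f̂(θ) - E f̂(θ)‖²_HS` of the estimator. -/
noncomputable def estimatorVariance {Ω H ι : Type*} [MeasurableSpace Ω] [NormedAddCommGroup H]
    [InnerProductSpace ℂ H] [CompleteSpace H] {d : ℕ} (P : Measure Ω) (e : HilbertBasis ι ℂ H)
    (X : EuclideanSpace ℝ (Fin d) → Ω → H) (K : EuclideanSpace ℝ (Fin d) → ℝ)
    (𝕋 : Finset (EuclideanSpace ℝ (Fin d))) (Δ : ℝ) (θ : EuclideanSpace ℝ (Fin d)) : ℝ≥0∞ :=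
  ∫⁻ ω, hsNorm e (estimator X K 𝕋 Δ θ ω - ∫ ω', estimator X K 𝕋 Δ θ ω' ∂P) ^ 2 ∂P

end Sampling

end SpectralVar

/-! The estimator is a finite sum of coefficients times operators `X t ⊗ X s`, so its variance is at
most the sum over pairs of pairs of the moduli of the coefficients times the modulus of the
covariance (`lintegral_hsSq_sub_integral_le`). By the definition of the cumulant and the reality of
the process, this covariance is a fourth-order cumulant plus two products of second-order terms,
each factor bounded by a trace norm of `C` at a lag joining one pair to the other
(`enorm_cov_outer_le`).

Each coefficient is at most `(b|T|)⁻¹|V(t)||V(s)|`, and vanishes unless `‖t - s‖ ≤ RΔ`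
(`enorm_estimatorCoeff_le`). The factor `b` exists because the rescaled regions eventually contain a
fixed ball, while the rescaled lags tend to zero (`exists_volume_inter_ge`). The phase has modulus
one, so every bound is uniform in `θ`.

What remains is a quadruple Riemann sum over Voronoi cells. With one pair fixed, the sum over the
other is bounded, by integrability of `C` or of the cumulants. The fixed pair then contributes `|T|`
for one point and order `Δ^d` for its neighbour within `RΔ`, where `δ_n = O(Δ_n)` enters. The total
is of order `|T|Δ^d/|T|² = Δ^d/|T|` (`sum_sum_weights_mul_le`). -/

namespace SpectralVar

/-! ### Hilbert–Schmidt and trace norms. -/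

section Operators

variable {H ι : Type*} [NormedAddCommGroup H] [InnerProductSpace ℂ H]

theorem outer_apply (x y z : H) : outer x y z = inner ℂ y z • x := rfl

theorem norm_outer (x y : H) : ‖outer x y‖ = ‖x‖ * ‖y‖ :=
  InnerProductSpace.norm_rankOne x y

theorem continuous_outer : Continuous fun p : H × H => outer p.1 p.2 :=
  ((ContinuousLinearMap.smulRightL ℂ H H).continuous.comp
    ((innerSL ℂ).continuous.comp continuous_snd)).clm_apply continuous_fst

/-- Distinct basis vectors are `√2` apart, so half-unit balls around them are disjoint. Countability
is what allows sums over the basis to be exchanged with expectations. -/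
theorem countable_of_hilbertBasis [TopologicalSpace.SeparableSpace H]
    (e : HilbertBasis ι ℂ H) : Countable ι := by
  have hd : Pairwise fun i j => Disjoint (Metric.ball (e i) (1 / 2)) (Metric.ball (e j) (1 / 2)) := by
    intro i j hij
    apply Metric.ball_disjoint_ball
    have h : ‖e i - e j‖ ^ 2 = 2 := by
      rw [@norm_sub_sq ℂ, e.orthonormal.1 i, e.orthonormal.1 j, e.orthonormal.2 hij]
      norm_num
    rw [dist_eq_norm]
    nlinarith [norm_nonneg (e i - e j)]
  exact Pairwise.countable_of_isOpen_disjoint hd (fun _ => Metric.isOpen_ball)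
    fun i => ⟨e i, by simp⟩

theorem hasSum_norm_inner_sq (e : HilbertBasis ι ℂ H) (x : H) :
    HasSum (fun j => ‖inner ℂ (e j) x‖ ^ 2) (‖x‖ ^ 2) := by
  have h := Complex.hasSum_re (e.hasSum_inner_mul_inner x x)
  convert h using 2 with j
  · rw [← inner_conj_symm x (e j), ← Complex.normSq_eq_conj_mul_self, Complex.normSq_eq_norm_sq,
      Complex.ofReal_re]
  · rw [inner_self_eq_norm_sq_to_K]
    simp [← Complex.ofReal_pow]

theorem tsum_enorm_inner_sq (e : HilbertBasis ι ℂ H) (x : H) :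
    ∑' j, ‖inner ℂ (e j) x‖ₑ ^ 2 = ‖x‖ₑ ^ 2 := by
  have h := hasSum_norm_inner_sq e x
  have h2 := ENNReal.ofReal_tsum_of_nonneg (fun j => sq_nonneg ‖inner ℂ (e j) x‖) h.summable
  rw [h.tsum_eq] at h2
  simpa only [ENNReal.ofReal_pow (norm_nonneg _), ofReal_norm] using h2.symm

theorem tsum_mul_le_sqrt_mul_sqrt (f g : ι → ℝ≥0∞) :
    ∑' i, f i * g i ≤ (∑' i, f i ^ 2) ^ (1 / 2 : ℝ) * (∑' i, g i ^ 2) ^ (1 / 2 : ℝ) := by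
  rw [ENNReal.tsum_eq_iSup_sum]
  refine iSup_le fun s => (ENNReal.inner_le_Lp_mul_Lq s f g Real.HolderConjugate.two_two).trans ?_
  simp only [ENNReal.rpow_two]
  gcongr <;> exact ENNReal.sum_le_tsum s

/-- The squared Hilbert-Schmidt norm, computed in the basis `e`. -/
noncomputable def hsSq (e : HilbertBasis ι ℂ H) (A : H →L[ℂ] H) : ℝ≥0∞ :=
  ∑' j, ‖A (e j)‖ₑ ^ 2

theorem hsSq_comp_le_of_contraction (e : HilbertBasis ι ℂ H) {U : H →L[ℂ] H}
    (hU : ∀ x, ‖U x‖ ≤ ‖x‖) (B : H →L[ℂ] H) :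
    hsSq e (U ∘L B) ≤ hsSq e B := by
  refine ENNReal.tsum_le_tsum fun j => ?_
  gcongr
  exact enorm_le_iff_norm_le.2 (hU _)

theorem tsum_enorm_inner_le (e : HilbertBasis ι ℂ H) (A B : H →L[ℂ] H) :
    ∑' j, ‖inner ℂ (A (e j)) (B (e j))‖ₑ ≤ hsSq e A ^ (1 / 2 : ℝ) * hsSq e B ^ (1 / 2 : ℝ) := by
  refine le_trans (ENNReal.tsum_le_tsum fun j => ?_) (tsum_mul_le_sqrt_mul_sqrt _ _)
  simp only [enorm_eq_nnnorm]
  exact_mod_cast nnnorm_inner_le_nnnorm _ _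

theorem hsSq_outer (e : HilbertBasis ι ℂ H) (x y : H) : hsSq e (outer x y) = ‖x‖ₑ ^ 2 * ‖y‖ₑ ^ 2 := by
  rw [← tsum_enorm_inner_sq e y, ← ENNReal.tsum_mul_left]
  refine tsum_congr fun j => ?_
  rw [outer_apply, enorm_smul, mul_pow, mul_comm, ← inner_conj_symm y, RCLike.enorm_conj]

variable [CompleteSpace H] (e : HilbertBasis ι ℂ H)

/-- By Parseval both sides are the same double sum of squared matrix entries, with the order of
summation exchanged. -/
theorem hsSq_adjoint (A : H →L[ℂ] H) : hsSq e A.adjoint = hsSq e A := by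
  unfold hsSq
  simp_rw [← tsum_enorm_inner_sq e (_)]
  rw [ENNReal.tsum_comm]
  congr! 5 with j i
  rw [ContinuousLinearMap.adjoint_inner_right, ← inner_conj_symm]
  exact (RCLike.enorm_conj _)

theorem enorm_apply_sq_le (A : H →L[ℂ] H) (x : H) : ‖A x‖ₑ ^ 2 ≤ ‖x‖ₑ ^ 2 * hsSq e A := by
  rw [← hsSq_adjoint, hsSq, ← tsum_enorm_inner_sq e, ← ENNReal.tsum_mul_left]
  refine ENNReal.tsum_le_tsum fun j => ?_
  rw [← mul_pow, mul_comm ‖x‖ₑ, ← ContinuousLinearMap.adjoint_inner_left]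
  gcongr
  simp only [enorm_eq_nnnorm]
  exact_mod_cast nnnorm_inner_le_nnnorm _ _

theorem hsSq_comp_le (A B : H →L[ℂ] H) : hsSq e (A ∘L B) ≤ hsSq e A * hsSq e B := by
  rw [hsSq.eq_1 e B, ← ENNReal.tsum_mul_left]
  refine ENNReal.tsum_le_tsum fun j => ?_
  rw [mul_comm]
  exact enorm_apply_sq_le e A _

/-- Since `|A|² = A*A`, the map `|A|x ↦ Ax` is well defined and isometric, which is the input to
polar decomposition. -/
theorem norm_abs_apply (A : H →L[ℂ] H) (x : H) : ‖CFC.abs A x‖ = ‖A x‖ := by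
  have hp := (ContinuousLinearMap.nonneg_iff_isPositive _).1 (CFC.abs_nonneg A)
  have h2 : CFC.abs A (CFC.abs A x) = A.adjoint (A x) := by
    have := congrArg (fun B : H →L[ℂ] H => B x) (CFC.abs_mul_abs A)
    simpa [ContinuousLinearMap.star_eq_adjoint] using this
  have h3 : inner ℂ (CFC.abs A x) (CFC.abs A x) = inner ℂ (A x) (A x) := by
    rw [← ContinuousLinearMap.adjoint_inner_right, hp.isSelfAdjoint.adjoint_eq, h2,
      ContinuousLinearMap.adjoint_inner_right]
  rw [inner_self_eq_norm_sq_to_K, inner_self_eq_norm_sq_to_K] at h3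
  have h4 : ‖CFC.abs A x‖ ^ 2 = ‖A x‖ ^ 2 := by exact_mod_cast h3
  exact (sq_eq_sq₀ (norm_nonneg _) (norm_nonneg _)).1 h4

/-- Polar decomposition with a contraction. -/
theorem exists_contraction_comp_abs (A : H →L[ℂ] H) :
    ∃ U : H →L[ℂ] H, (∀ x, ‖U x‖ ≤ ‖x‖) ∧ U ∘L CFC.abs A = A := by
  set D := CFC.abs A with hD
  let M : Submodule ℂ H := D.range.topologicalClosure
  have : CompleteSpace M := D.range.isClosed_topologicalClosure.completeSpace_coe
  let D' : H →ₗ[ℂ] M := LinearMap.codRestrict M D.toLinearMap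
    fun x => D.range.le_topologicalClosure ⟨x, rfl⟩
  have hdense : DenseRange D' := by
    intro y
    have hy : (y : H) ∈ closure (D.range : Set H) := y.2
    rw [closure_subtype]
    convert hy using 2
    ext z
    constructor
    · rintro ⟨_, ⟨x, rfl⟩, rfl⟩
      exact ⟨x, rfl⟩
    · rintro ⟨x, rfl⟩
      exact ⟨_, ⟨x, rfl⟩, rfl⟩
  have hb : ∀ x, ‖A.toLinearMap x‖ ≤ 1 * ‖D' x‖ := fun x => by
    rw [one_mul]
    exact (norm_abs_apply A x).ge
  -- The map `|A|x ↦ Ax` is extended to the closure of the range of `|A|` by density, and by zero on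
  -- its orthogonal complement.
  refine ⟨(A.toLinearMap.extendOfNorm D') ∘L M.orthogonalProjectionOnto, fun x => ?_, ?_⟩
  · have h1 := LinearMap.norm_extendOfNorm_apply_le hdense 1 hb (M.orthogonalProjectionOnto x)
    rw [one_mul] at h1
    exact h1.trans (M.norm_orthogonalProjectionOnto_apply_le x)
  · ext x
    have h1 : M.orthogonalProjectionOnto (D x) = D' x :=
      M.orthogonalProjectionOnto_mem_subspace_eq_self (D' x)
    have h2 := LinearMap.extendOfNorm_eq hdense ⟨1, hb⟩ x
    simp only [ContinuousLinearMap.comp_apply, h1]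
    exact h2

theorem tsum_ofReal_diag_comp_self (B : H →L[ℂ] H) (hB : IsSelfAdjoint B) :
    ∑' j, ENNReal.ofReal (inner ℂ (e j) ((B ∘L B) (e j))).re = hsSq e B := by
  refine tsum_congr fun j => ?_
  rw [ContinuousLinearMap.comp_apply, ← ContinuousLinearMap.adjoint_inner_left, hB.adjoint_eq,
    inner_self_eq_norm_sq_to_K, ← ofReal_norm, ← ENNReal.ofReal_pow (norm_nonneg _)]
  congr 1
  simp [← Complex.ofReal_pow]

/-- Taking `B = |A|^{1/2}` turns trace-norm estimates into Cauchy–Schwarz for Hilbert–Schmidt norms.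
-/
theorem exists_sqrt_abs (A : H →L[ℂ] H) : ∃ B : H →L[ℂ] H, IsSelfAdjoint B ∧
    B ∘L B = CFC.abs A ∧ traceNorm e A = hsSq e B := by
  have h1 : CFC.sqrt (CFC.abs A) ∘L CFC.sqrt (CFC.abs A) = CFC.abs A :=
    CFC.sqrt_mul_sqrt_self _ (CFC.abs_nonneg A)
  have h2 : IsSelfAdjoint (CFC.sqrt (CFC.abs A)) := (CFC.sqrt_nonneg _).isSelfAdjoint
  refine ⟨CFC.sqrt (CFC.abs A), h2, h1, ?_⟩
  rw [← tsum_ofReal_diag_comp_self e _ h2, h1, traceNorm]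

/-- With `A = UB²`, the diagonal entries are `⟨B(WU)*e_j, Be_j⟩`. Cauchy–Schwarz leaves two
Hilbert–Schmidt norms, and the contraction `WU` does not increase the first. The extra `W` serves
the triangle inequality. -/
theorem tsum_enorm_diag_comp_le_traceNorm {W : H →L[ℂ] H} (hW : ∀ x, ‖W x‖ ≤ ‖x‖)
    (A : H →L[ℂ] H) : ∑' j, ‖inner ℂ (e j) (W (A (e j)))‖ₑ ≤ traceNorm e A := by
  obtain ⟨B, hB, hBB, htr⟩ := exists_sqrt_abs e A
  obtain ⟨U, hU, hUA⟩ := exists_contraction_comp_abs A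
  have hj : ∀ j, ‖inner ℂ (e j) (W (A (e j)))‖ₑ ≤
      ‖(B ∘L (W ∘L U).adjoint) (e j)‖ₑ * ‖B (e j)‖ₑ := by
    intro j
    have : inner ℂ (e j) (W (A (e j))) =
        inner ℂ ((B ∘L (W ∘L U).adjoint) (e j)) (B (e j)) := by
      conv_lhs => rw [← hUA, ← hBB]
      rw [ContinuousLinearMap.comp_apply B, ← ContinuousLinearMap.adjoint_inner_right B,
        hB.adjoint_eq, ContinuousLinearMap.adjoint_inner_left]
      rfl
    rw [this]
    simp only [enorm_eq_nnnorm]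
    exact_mod_cast nnnorm_inner_le_nnnorm _ _
  have h1 : hsSq e (B ∘L (W ∘L U).adjoint) ≤ hsSq e B := by
    rw [← hsSq_adjoint, ContinuousLinearMap.adjoint_comp, ContinuousLinearMap.adjoint_adjoint,
      hB.adjoint_eq]
    exact hsSq_comp_le_of_contraction e (fun x => (hW (U x)).trans (hU x)) B
  calc _ ≤ _ := ENNReal.tsum_le_tsum hj
    _ ≤ _ := tsum_mul_le_sqrt_mul_sqrt _ _
    _ ≤ hsSq e B ^ (1 / 2 : ℝ) * hsSq e B ^ (1 / 2 : ℝ) := by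
      gcongr
      · exact h1
      · exact le_rfl
    _ = traceNorm e A := by
      rw [htr, ← ENNReal.rpow_add_of_nonneg _ _ (by norm_num) (by norm_num)]
      norm_num

theorem tsum_enorm_diag_le_traceNorm (A : H →L[ℂ] H) :
    ∑' j, ‖inner ℂ (e j) (A (e j))‖ₑ ≤ traceNorm e A :=
  tsum_enorm_diag_comp_le_traceNorm e (W := ContinuousLinearMap.id ℂ H) (fun _ => le_rfl) A

theorem exists_contraction_comp_eq_abs (A : H →L[ℂ] H) :
    ∃ W : H →L[ℂ] H, (∀ x, ‖W x‖ ≤ ‖x‖) ∧ W ∘L A = CFC.abs A := by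
  obtain ⟨U, hU, hUA⟩ := exists_contraction_comp_abs A
  have hW : ∀ x, ‖U.adjoint x‖ ≤ ‖x‖ := fun x => by
    have h1 : ‖U.adjoint‖ ≤ 1 := by
      rw [LinearIsometryEquiv.norm_map]
      exact U.opNorm_le_bound zero_le_one fun y => by simpa using hU y
    simpa using (U.adjoint.le_opNorm x).trans (mul_le_mul_of_nonneg_right h1 (norm_nonneg x))
  refine ⟨U.adjoint, hW, ?_⟩
  ext x
  have hUD : U (CFC.abs A x) = A x := congrArg (fun B : H →L[ℂ] H => B x) hUA
  have h2 : (inner ℂ (U.adjoint (A x)) (CFC.abs A x)).re = ‖CFC.abs A x‖ ^ 2 := by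
    rw [ContinuousLinearMap.adjoint_inner_left, hUD, norm_abs_apply, inner_self_eq_norm_sq_to_K]
    simp [← Complex.ofReal_pow]
  -- Expanding the square gives `‖U*Ax‖² - ‖|A|x‖²`, which is nonpositive because `U*` is a
  -- contraction and `‖Ax‖ = ‖|A|x‖`.
  have h3 : ‖U.adjoint (A x) - CFC.abs A x‖ ^ 2 ≤ 0 := by
    have h4 := (hW (A x)).trans_eq (norm_abs_apply A x).symm
    rw [@norm_sub_sq ℂ]
    simp only [RCLike.re_to_complex, h2]
    nlinarith [norm_nonneg (U.adjoint (A x))]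
  rw [ContinuousLinearMap.comp_apply, ← sub_eq_zero, ← norm_eq_zero]
  exact pow_eq_zero_iff two_ne_zero |>.1 (le_antisymm h3 (sq_nonneg _))

/-- Writing `|A+B| = W(A+B)` makes the trace of `|A+B|` linear in `A` and `B` for a fixed
contraction `W`. -/
theorem traceNorm_add_le (A B : H →L[ℂ] H) :
    traceNorm e (A + B) ≤ traceNorm e A + traceNorm e B := by
  obtain ⟨W, hW, hWAB⟩ := exists_contraction_comp_eq_abs (A + B)
  refine le_trans ?_ (add_le_add (tsum_enorm_diag_comp_le_traceNorm e hW A)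
    (tsum_enorm_diag_comp_le_traceNorm e hW B))
  rw [traceNorm, ← hWAB, ← ENNReal.tsum_add]
  refine ENNReal.tsum_le_tsum fun j => ?_
  have h : inner ℂ (e j) ((W ∘L (A + B)) (e j)) =
      inner ℂ (e j) (W (A (e j))) + inner ℂ (e j) (W (B (e j))) := by
    simp
  rw [h]
  refine le_trans ?_ (enorm_add_le _ _)
  rw [← ofReal_norm]
  exact ENNReal.ofReal_le_ofReal (Complex.re_le_norm _)

theorem hsSq_le_traceNorm_sq (A : H →L[ℂ] H) : hsSq e A ≤ traceNorm e A ^ 2 := by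
  obtain ⟨B, -, hBB, htr⟩ := exists_sqrt_abs e A
  have h : hsSq e A = hsSq e (B ∘L B) := by
    rw [hBB]
    refine tsum_congr fun j => ?_
    rw [← ofReal_norm, ← ofReal_norm, norm_abs_apply]
  rw [h, htr, sq]
  exact hsSq_comp_le e B B

theorem hsInner_eq (A B : H →L[ℂ] H) :
    hsInner e A B = ∑' j, inner ℂ (A (e j)) (B (e j)) :=
  tsum_congr fun j => by
    rw [ContinuousLinearMap.comp_apply, ContinuousLinearMap.adjoint_inner_right]

theorem enorm_hsInner_le (A B : H →L[ℂ] H) :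
    ‖hsInner e A B‖ₑ ≤ traceNorm e A * traceNorm e B := by
  rw [hsInner_eq]
  refine enorm_tsum_le_tsum_enorm.trans ((tsum_enorm_inner_le e A B).trans ?_)
  have h : ∀ A : H →L[ℂ] H, hsSq e A ^ (1 / 2 : ℝ) ≤ traceNorm e A := fun A => by
    rw [one_div, ENNReal.rpow_inv_le_iff (by norm_num)]
    simpa using hsSq_le_traceNorm_sq e A
  gcongr <;> exact h _

theorem hasSum_hsInner {A B : H →L[ℂ] H} (hA : hsSq e A ≠ ∞) (hB : hsSq e B ≠ ∞) :
    HasSum (fun j => inner ℂ (A (e j)) (B (e j))) (hsInner e A B) := by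
  rw [hsInner_eq]
  apply Summable.hasSum
  apply Summable.of_enorm
  refine ((tsum_enorm_inner_le e A B).trans_lt ?_).ne
  exact ENNReal.mul_lt_top (ENNReal.rpow_lt_top_of_nonneg (by norm_num) hA)
    (ENNReal.rpow_lt_top_of_nonneg (by norm_num) hB)

/-- `A*A` is positive, hence its own absolute value, and its diagonal entries are `‖Ae_j‖²`. -/
theorem hsNorm_sq (A : H →L[ℂ] H) : hsNorm e A ^ 2 = hsSq e A := by
  have hpos : (0 : H →L[ℂ] H) ≤ A.adjoint ∘L A := star_mul_self_nonneg A
  rw [hsNorm, ← ENNReal.rpow_natCast, ← ENNReal.rpow_mul]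
  norm_num
  rw [traceNorm, CFC.abs_of_nonneg _ hpos]
  refine tsum_congr fun j => ?_
  rw [ContinuousLinearMap.comp_apply, ContinuousLinearMap.adjoint_inner_right,
    inner_self_eq_norm_sq_to_K, ← ofReal_norm, ← ENNReal.ofReal_pow (norm_nonneg _)]
  congr 1
  simp [← Complex.ofReal_pow]

end Operators

end SpectralVar

namespace SpectralVar

/-! ### Voronoi cells and Riemann sums. -/

section Voronoi

variable {d : ℕ} (𝕋 : Finset (EuclideanSpace ℝ (Fin d)))

theorem isCompact_region : IsCompact (region 𝕋) :=
  𝕋.finite_toSet.isCompact_convexHull ℝ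

theorem convex_region : Convex ℝ (region 𝕋) := convex_convexHull ℝ _

theorem cell_subset_region (t : EuclideanSpace ℝ (Fin d)) : cell 𝕋 t ⊆ region 𝕋 :=
  fun _ hx => hx.1

theorem isClosed_cell (t : EuclideanSpace ℝ (Fin d)) : IsClosed (cell 𝕋 t) := by
  have h : cell 𝕋 t = region 𝕋 ∩ ⋂ s ∈ 𝕋, {x | dist x t ≤ dist x s} := by
    ext x
    simp [cell]
  rw [h]
  refine (isCompact_region 𝕋).isClosed.inter (isClosed_biInter fun s _ => ?_)
  exact isClosed_le (continuous_id.dist continuous_const) (continuous_id.dist continuous_const)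

/-- Two distinct cells meet only inside the perpendicular bisector of their centres, a null
hyperplane. -/
theorem aedisjoint_cell :
    (𝕋 : Set (EuclideanSpace ℝ (Fin d))).Pairwise (Function.onFun (AEDisjoint volume) (cell 𝕋)) := by
  intro t ht s hs hts
  refine measure_mono_null (t := (AffineSubspace.perpBisector t s : Set _)) ?_
    (Measure.addHaar_affineSubspace volume _ fun h => hts (AffineSubspace.perpBisector_eq_top.1 h))
  rintro x ⟨hx, hx'⟩
  exact AffineSubspace.mem_perpBisector_iff_dist_eq.2 (le_antisymm (hx.2 s hs) (hx'.2 t ht))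

theorem volume_cell_ne_top (t : EuclideanSpace ℝ (Fin d)) : volume (cell 𝕋 t) ≠ ∞ :=
  measure_ne_top_of_subset (cell_subset_region 𝕋 t) (isCompact_region 𝕋).measure_ne_top

theorem edist_le_mesh {t x : EuclideanSpace ℝ (Fin d)} (ht : t ∈ 𝕋) (hx : x ∈ cell 𝕋 t) :
    edist x t ≤ mesh 𝕋 :=
  (le_iSup₂ (f := fun x (_ : x ∈ cell 𝕋 t) => edist x t) x hx).trans
    (le_iSup₂ (f := fun t (_ : t ∈ 𝕋) => ⨆ x ∈ cell 𝕋 t, edist x t) t ht)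

/-- A Riemann sum over the Voronoi cells is dominated by the integral of any function which
dominates the summands on the cells. -/
theorem sum_volume_cell_mul_le {g G : EuclideanSpace ℝ (Fin d) → ℝ≥0∞}
    (h : ∀ t ∈ 𝕋, ∀ x ∈ cell 𝕋 t, g t ≤ G x) :
    ∑ t ∈ 𝕋, volume (cell 𝕋 t) * g t ≤ ∫⁻ x, G x := by
  calc ∑ t ∈ 𝕋, volume (cell 𝕋 t) * g t ≤ ∑ t ∈ 𝕋, ∫⁻ x in cell 𝕋 t, G x := by
        refine Finset.sum_le_sum fun t ht => ?_
        rw [mul_comm, ← setLIntegral_const]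
        exact setLIntegral_mono' (isClosed_cell 𝕋 t).measurableSet (h t ht)
    _ = ∫⁻ x in ⋃ t ∈ 𝕋, cell 𝕋 t, G x :=
        (lintegral_biUnion_finset₀ (aedisjoint_cell 𝕋)
          (fun t _ => (isClosed_cell 𝕋 t).measurableSet.nullMeasurableSet) G).symm
    _ ≤ ∫⁻ x, G x := setLIntegral_le_lintegral _ _

theorem sum_volume_cell_le : ∑ t ∈ 𝕋, volume (cell 𝕋 t) ≤ volume (region 𝕋) := by
  have h := sum_volume_cell_mul_le 𝕋 (g := 1) (G := (region 𝕋).indicator 1)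
    fun t _ x hx => by simp [cell_subset_region 𝕋 t hx]
  rw [lintegral_indicator_one (isCompact_region 𝕋).measurableSet] at h
  simpa using h

end Voronoi

/-! ### Convex regions: inner balls and overlap of translates. -/

section Geometry

variable {E : Type*} [NormedAddCommGroup E] [InnerProductSpace ℝ E]

/-- A complete convex set which is Hausdorff-close to a superset of a ball contains the concentric
ball of half the radius. -/
theorem ball_half_subset_of_hausdorffEDist_lt {R T : Set E} (hne : R.Nonempty) (hR : IsComplete R)
    (hconv : Convex ℝ R) {x₀ : E} {r : ℝ} (hr : 0 < r) (hT : Metric.ball x₀ r ⊆ T)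
    (hd : Metric.hausdorffEDist R T < ENNReal.ofReal (r / 2)) : Metric.ball x₀ (r / 2) ⊆ R := by
  intro y hy
  by_contra hyR
  obtain ⟨p, hp, hpy⟩ := exists_norm_eq_iInf_of_complete_convex hne hR hconv y
  rw [norm_eq_iInf_iff_real_inner_le_zero hconv hp] at hpy
  have hyp : y - p ≠ 0 := fun h => hyR (by rwa [sub_eq_zero.1 h])
  have hn : 0 < ‖y - p‖ := norm_pos_iff.2 hyp
  set u : E := ‖y - p‖⁻¹ • (y - p) with hu
  have hu1 : ‖u‖ = 1 := by
    rw [hu, norm_smul, norm_inv, norm_norm, inv_mul_cancel₀ hn.ne']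
  -- Moving `y` by `r/2` along the outward normal at its projection `p` stays in `T`, but ends at
  -- distance at least `‖y - p‖ + r/2` from `R`, contradicting Hausdorff closeness.
  have hz : y + (r / 2) • u ∈ T := by
    apply hT
    rw [Metric.mem_ball, dist_eq_norm] at hy ⊢
    calc ‖y + (r / 2) • u - x₀‖ = ‖(y - x₀) + (r / 2) • u‖ := by congr 1; abel
      _ ≤ ‖y - x₀‖ + ‖(r / 2) • u‖ := norm_add_le _ _
      _ < r / 2 + r / 2 := by
        rw [norm_smul, hu1, mul_one, Real.norm_of_nonneg (by positivity)]
        linarith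
      _ = r := by ring
  rw [Metric.hausdorffEDist_comm] at hd
  obtain ⟨q, hq, hzq⟩ := Metric.exists_edist_lt_of_hausdorffEDist_lt hz hd
  rw [edist_dist, ENNReal.ofReal_lt_ofReal_iff (by positivity), dist_eq_norm] at hzq
  have h1 : inner ℝ (y + (r / 2) • u - q) u ≤ ‖y + (r / 2) • u - q‖ := by
    have := real_inner_le_norm (y + (r / 2) • u - q) u
    rwa [hu1, mul_one] at this
  have h2 : inner ℝ (y + (r / 2) • u - q) u
      = inner ℝ (y - p) u + r / 2 * inner ℝ u u - inner ℝ (q - p) u := by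
    rw [← real_inner_smul_left, ← inner_add_left, ← inner_sub_left]
    congr 1
    abel
  have h3 : inner ℝ (y - p) u = ‖y - p‖ := by
    rw [hu, real_inner_smul_right, real_inner_self_eq_norm_sq]
    field_simp
  have h4 : inner ℝ (q - p) u ≤ 0 := by
    rw [hu, real_inner_smul_right, real_inner_comm]
    exact mul_nonpos_of_nonneg_of_nonpos (by positivity) (hpy q hq)
  rw [h2, h3, real_inner_self_eq_norm_sq, hu1] at h1
  linarith

end Geometry

section Overlap

variable {d : ℕ} {𝕋 : ℕ → Finset (EuclideanSpace ℝ (Fin d))}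

theorem SamplingCondition.dim_ne_zero (hS : SamplingCondition 𝕋) : d ≠ 0 := by
  rintro rfl
  obtain ⟨n, hn⟩ := (hS.volume_tendsto.eventually_gt_atTop
    (volume.real (Set.univ : Set (EuclideanSpace ℝ (Fin 0))))).exists
  exact hn.not_ge (measureReal_mono (Set.subset_univ _) isCompact_univ.measure_ne_top)

theorem SamplingCondition.exists_ball (hS : SamplingCondition 𝕋) :
    ∃ x₀ : EuclideanSpace ℝ (Fin d), ∃ r > (0 : ℝ), ∀ᶠ n in atTop, Metric.ball x₀ r ⊆
      ((volume.real (region (𝕋 n)) ^ (1 / (d : ℝ)))⁻¹ : ℝ) • region (𝕋 n) := by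
  obtain ⟨T, -, -, ⟨x₀, hx₀⟩, hlim⟩ := hS.shape
  obtain ⟨r, hr, hball⟩ := Metric.isOpen_iff.1 isOpen_interior x₀ hx₀
  refine ⟨x₀, r / 2, by positivity, ?_⟩
  filter_upwards [hlim.eventually_lt_const (ENNReal.ofReal_pos.2 (half_pos hr)),
    hS.volume_tendsto.eventually_gt_atTop 0] with n hn hpos
  have hne : (region (𝕋 n)).Nonempty := by
    by_contra h
    rw [Set.not_nonempty_iff_eq_empty.1 h] at hpos
    simp at hpos
  exact ball_half_subset_of_hausdorffEDist_lt hne.smul_set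
    ((isCompact_region (𝕋 n)).smul _).isComplete ((convex_region (𝕋 n)).smul _) hr
    (hball.trans interior_subset) hn

/-- Translates by lags of the order of the bandwidth overlap with the sampling region in a fixed
proportion. -/
theorem SamplingCondition.exists_volume_inter_ge (hS : SamplingCondition 𝕋) {Δ : ℕ → ℝ}
    (hΔpos : ∀ n, 0 < Δ n)
    (hΔvol : Tendsto (fun n => Δ n ^ d / volume.real (region (𝕋 n))) atTop (𝓝 0)) (R : ℝ) :
    ∃ c > (0 : ℝ), ∀ᶠ n in atTop, ∀ h : EuclideanSpace ℝ (Fin d), ‖h‖ ≤ R * Δ n →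
      c * volume.real (region (𝕋 n)) ≤
        volume.real (region (𝕋 n) ∩ (fun x => x - h) '' region (𝕋 n)) := by
  have hd := hS.dim_ne_zero
  obtain ⟨x₀, r, hr, hball⟩ := hS.exists_ball
  have hscale : Tendsto (fun n => R * (Δ n ^ d / volume.real (region (𝕋 n))) ^ (1 / (d : ℝ)))
      atTop (𝓝 0) := by
    have := (hΔvol.rpow_const (p := 1 / (d : ℝ)) (Or.inr (by positivity))).const_mul R
    rwa [Real.zero_rpow (by positivity), mul_zero] at this
  -- Once the rescaled lag is shorter than `r/2`, a point of the half-radius ball and its translate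
  -- both lie in the full ball, so the overlap contains the half-radius ball scaled back by `a`,
  -- where `a^d = V`.
  refine ⟨volume.real (Metric.ball x₀ (r / 2)),
    ENNReal.toReal_pos (Metric.measure_ball_pos _ _ (by positivity)).ne' measure_ball_lt_top.ne, ?_⟩
  filter_upwards [hball, hscale.eventually_lt_const (half_pos hr),
    hS.volume_tendsto.eventually_gt_atTop 0] with n hn hlt hpos h hh
  set V := volume.real (region (𝕋 n)) with hV
  set a := V ^ (1 / (d : ℝ)) with ha
  have ha' : a = V ^ (d : ℝ)⁻¹ := by rw [ha, one_div]
  have ha0 : 0 < a := by positivity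
  have had : a ^ d = V := by
    rw [ha, one_div, Real.rpow_inv_natCast_pow hpos.le hd]
  have hmem : ∀ z ∈ Metric.ball x₀ r, a • z ∈ region (𝕋 n) := by
    intro z hz
    have := hn hz
    rwa [Set.mem_inv_smul_set_iff₀ ha0.ne'] at this
  have hsmall : ‖a⁻¹ • h‖ < r / 2 := by
    refine lt_of_le_of_lt ?_ hlt
    rw [norm_smul, norm_inv, Real.norm_of_nonneg ha0.le,
      Real.div_rpow (pow_nonneg (hΔpos n).le d) hpos.le, one_div,
      Real.pow_rpow_inv_natCast (hΔpos n).le hd, ← ha', inv_mul_eq_div, ← mul_div_assoc]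
    gcongr
  have hsub : a • Metric.ball x₀ (r / 2) ⊆
      region (𝕋 n) ∩ (fun x => x - h) '' region (𝕋 n) := by
    rintro _ ⟨z, hz, rfl⟩
    refine ⟨hmem z (Metric.ball_subset_ball (by linarith) hz), a • (z + a⁻¹ • h), hmem _ ?_, ?_⟩
    · rw [Metric.mem_ball, dist_eq_norm] at hz ⊢
      calc ‖z + a⁻¹ • h - x₀‖ = ‖(z - x₀) + a⁻¹ • h‖ := by congr 1; abel
        _ ≤ ‖z - x₀‖ + ‖a⁻¹ • h‖ := norm_add_le _ _
        _ < r := by linarith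
    · simp [smul_smul, ha0.ne']
  calc volume.real (Metric.ball x₀ (r / 2)) * V
      = volume.real (a • Metric.ball x₀ (r / 2)) := by
        simp only [measureReal_def, Measure.addHaar_smul, ENNReal.toReal_mul,
          finrank_euclideanSpace, Fintype.card_fin, had]
        rw [abs_of_pos hpos, ENNReal.toReal_ofReal hpos.le, mul_comm]
    _ ≤ _ := measureReal_mono hsub
        (measure_ne_top_of_subset Set.inter_subset_left (isCompact_region _).measure_ne_top)

end Overlap

end SpectralVar

namespace SpectralVar

/-! ### Exchange of sums and expectations, and second moments. -/

section Integration

variable {Ω : Type*} [MeasurableSpace Ω] {P : Measure Ω}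

theorem hasSum_integral_of_lintegral_tsum_ne_top {ι E : Type*} [Countable ι]
    [NormedAddCommGroup E] [NormedSpace ℝ E] {F : ι → Ω → E} {f : Ω → E}
    (hF : ∀ i, AEStronglyMeasurable (F i) P) (h : ∫⁻ ω, ∑' i, ‖F i ω‖ₑ ∂P ≠ ∞)
    (hs : ∀ᵐ ω ∂P, HasSum (fun i => F i ω) (f ω)) :
    HasSum (fun i => ∫ ω, F i ω ∂P) (∫ ω, f ω ∂P) := by
  rw [lintegral_tsum fun i => (hF i).enorm] at h
  have hint : ∀ i, Integrable (F i) P := fun i =>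
    ⟨hF i, (ENNReal.ne_top_of_tsum_ne_top h i).lt_top⟩
  have hsum : Summable fun i => ∫ ω, ‖F i ω‖ ∂P := by
    convert ENNReal.summable_toReal h using 2 with i
    rw [integral_norm_eq_lintegral_enorm (hF i)]
  have key := hasSum_integral_of_summable_integral_norm hint hsum
  rwa [integral_congr_ae (hs.mono fun ω hω => hω.tsum_eq)] at key

theorem memLp_two_of_lintegral_enorm_sq_ne_top {E : Type*} [NormedAddCommGroup E] {f : Ω → E}
    (hf : AEStronglyMeasurable f P) (h : ∫⁻ ω, ‖f ω‖ₑ ^ 2 ∂P ≠ ∞) : MemLp f 2 P := by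
  refine ⟨hf, (eLpNorm_lt_top_iff_lintegral_rpow_enorm_lt_top (by norm_num) (by norm_num)).2 ?_⟩
  simpa using h.lt_top

variable {H : Type*} [NormedAddCommGroup H] [InnerProductSpace ℂ H]

theorem integrable_inner_of_memLp_two {f g : Ω → H} (hf : MemLp f 2 P) (hg : MemLp g 2 P) :
    Integrable (fun ω => inner ℂ (f ω) (g ω)) P :=
  (hf.norm.integrable_mul hg.norm).mono' (hf.1.inner hg.1)
    (Eventually.of_forall fun _ => norm_inner_le_norm _ _)

theorem integral_inner_sub_integral [IsProbabilityMeasure P] [CompleteSpace H] {f g : Ω → H}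
    (hf : MemLp f 2 P) (hg : MemLp g 2 P) :
    ∫ ω, inner ℂ (f ω - ∫ ω', f ω' ∂P) (g ω - ∫ ω', g ω' ∂P) ∂P =
      (∫ ω, inner ℂ (f ω) (g ω) ∂P) - inner ℂ (∫ ω', f ω' ∂P) (∫ ω', g ω' ∂P) := by
  have hf1 := hf.integrable (by norm_num)
  have hg1 := hg.integrable (by norm_num)
  set c := ∫ ω', f ω' ∂P with hc
  set b := ∫ ω', g ω' ∂P with hb
  have h1 : ∫ ω, inner ℂ (f ω) b ∂P = inner ℂ c b := by
    have := integral_inner (𝕜 := ℂ) hf1 b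
    rw [← inner_conj_symm, ← this, ← integral_conj]
    simp only [inner_conj_symm]
  have h2 : ∫ ω, inner ℂ c (g ω) ∂P = inner ℂ c b := integral_inner hg1 c
  simp_rw [inner_sub_left, inner_sub_right]
  rw [integral_sub, integral_sub, integral_sub, h1, h2]
  · simp
  · exact hg1.const_inner c
  · exact integrable_const _
  · exact integrable_inner_of_memLp_two hf hg
  · exact hf1.inner_const b
  · exact (integrable_inner_of_memLp_two hf hg).sub (hf1.inner_const b)
  · exact (hg1.const_inner c).sub (integrable_const _)

/-- Jensen's inequality, via the contraction from `L²` to `L¹` norms on a probability space. -/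
theorem enorm_integral_sq_le [IsProbabilityMeasure P] {E : Type*} [NormedAddCommGroup E]
    [NormedSpace ℝ E] {f : Ω → E} (hf : AEStronglyMeasurable f P) :
    ‖∫ ω, f ω ∂P‖ₑ ^ 2 ≤ ∫⁻ ω, ‖f ω‖ₑ ^ 2 ∂P := by
  have h1 := eLpNorm_le_eLpNorm_of_exponent_le (p := 1) (q := 2) (by norm_num) hf
  rw [eLpNorm_one_eq_lintegral_enorm,
    eLpNorm_eq_lintegral_rpow_enorm_toReal (by norm_num) (by norm_num)] at h1
  have h2 := (enorm_integral_le_lintegral_enorm f).trans h1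
  simp only [ENNReal.toReal_ofNat, one_div, ENNReal.rpow_ofNat] at h2
  rw [ENNReal.le_rpow_inv_iff (by norm_num)] at h2
  simpa using h2

end Integration

/-! ### Covariances of random Hilbert–Schmidt operators. -/

section RandomOperators

variable {Ω : Type*} [MeasurableSpace Ω] {P : Measure Ω} {H ι κ : Type*} [NormedAddCommGroup H]
  [InnerProductSpace ℂ H] [CompleteSpace H] (e : HilbertBasis ι ℂ H)

omit [CompleteSpace H] in
-- Jensen in each coordinate. It makes the mean operators Hilbert–Schmidt, so that the series for
-- their inner products converge.
theorem hsSq_integral_le [Countable ι] [IsProbabilityMeasure P] {A : Ω → H →L[ℂ] H}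
    (hA : Integrable A P) : hsSq e (∫ ω, A ω ∂P) ≤ ∫⁻ ω, hsSq e (A ω) ∂P := by
  unfold hsSq
  rw [lintegral_tsum fun j => ((hA.1.apply_continuousLinearMap (e j)).enorm).pow_const 2]
  refine ENNReal.tsum_le_tsum fun j => ?_
  rw [ContinuousLinearMap.integral_apply hA]
  exact enorm_integral_sq_le (hA.1.apply_continuousLinearMap (e j))

theorem hasSum_integral_hsInner [Countable ι] {A B : Ω → H →L[ℂ] H}
    (hA : AEStronglyMeasurable A P) (hB : AEStronglyMeasurable B P)
    (hA2 : ∫⁻ ω, hsSq e (A ω) ∂P ≠ ∞) (hB2 : ∫⁻ ω, hsSq e (B ω) ∂P ≠ ∞) :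
    HasSum (fun j => ∫ ω, inner ℂ (A ω (e j)) (B ω (e j)) ∂P)
      (∫ ω, hsInner e (A ω) (B ω) ∂P) := by
  have hAm : ∀ j, AEStronglyMeasurable (fun ω => A ω (e j)) P :=
    fun j => hA.apply_continuousLinearMap (e j)
  have hBm : ∀ j, AEStronglyMeasurable (fun ω => B ω (e j)) P :=
    fun j => hB.apply_continuousLinearMap (e j)
  have hAs : AEMeasurable (fun ω => hsSq e (A ω)) P :=
    AEMeasurable.tsum fun j => (hAm j).enorm.pow_const 2
  have hBs : AEMeasurable (fun ω => hsSq e (B ω)) P :=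
    AEMeasurable.tsum fun j => (hBm j).enorm.pow_const 2
  refine hasSum_integral_of_lintegral_tsum_ne_top (fun j => (hAm j).inner (hBm j)) ?_ ?_
  · refine ((lintegral_mono fun ω => ?_).trans_lt (b := ∫⁻ ω, hsSq e (A ω) + hsSq e (B ω) ∂P) ?_).ne
    · refine ENNReal.tsum_add.symm ▸ ENNReal.tsum_le_tsum fun j => ?_
      have h1 : ‖inner ℂ (A ω (e j)) (B ω (e j))‖ₑ ≤ ‖A ω (e j)‖ₑ * ‖B ω (e j)‖ₑ := by
        simp only [enorm_eq_nnnorm]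
        exact_mod_cast nnnorm_inner_le_nnnorm _ _
      refine h1.trans ?_
      rcases le_total ‖A ω (e j)‖ₑ ‖B ω (e j)‖ₑ with h | h
      · exact le_add_left ((mul_le_mul_left h _).trans_eq (sq _).symm)
      · exact le_add_right ((mul_le_mul_right h _).trans_eq (sq _).symm)
    · rw [lintegral_add_left' hAs]
      exact ENNReal.add_lt_top.2 ⟨hA2.lt_top, hB2.lt_top⟩
  · filter_upwards [ae_lt_top' hAs hA2, ae_lt_top' hBs hB2] with ω h1 h2
    exact hasSum_hsInner e h1.ne h2.ne

/-- The variance of a linear combination of random Hilbert-Schmidt operators is bounded by the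
sum of the moduli of their covariances. -/
theorem lintegral_hsSq_sub_integral_le [Countable ι] [IsProbabilityMeasure P] (s : Finset κ)
    (a : κ → ℂ) {A : κ → Ω → H →L[ℂ] H} (hA : ∀ p ∈ s, Integrable (A p) P)
    (hA2 : ∀ p ∈ s, ∫⁻ ω, hsSq e (A p ω) ∂P ≠ ∞) :
    ∫⁻ ω, hsSq e ((∑ p ∈ s, a p • A p ω) - ∫ ω', ∑ p ∈ s, a p • A p ω' ∂P) ∂P ≤
      ∑ p ∈ s, ∑ q ∈ s, ‖a p‖ₑ * ‖a q‖ₑ *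
        ‖(∫ ω, hsInner e (A p ω) (A q ω) ∂P) -
          hsInner e (∫ ω, A p ω ∂P) (∫ ω, A q ω ∂P)‖ₑ := by
  have hAm : ∀ p ∈ s, ∀ j, AEStronglyMeasurable (fun ω => A p ω (e j)) P :=
    fun p hp j => (hA p hp).1.apply_continuousLinearMap (e j)
  have hL2 : ∀ p ∈ s, ∀ j, MemLp (fun ω => A p ω (e j)) 2 P := fun p hp j =>
    memLp_two_of_lintegral_enorm_sq_ne_top (hAm p hp j)
      ((lintegral_mono fun ω => ENNReal.le_tsum j).trans_lt (hA2 p hp).lt_top).ne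
  set C : κ → H →L[ℂ] H := fun p => ∫ ω, A p ω ∂P with hC
  have hCj : ∀ p ∈ s, ∀ j, C p (e j) = ∫ ω, A p ω (e j) ∂P := fun p hp j =>
    ContinuousLinearMap.integral_apply (hA p hp) _
  have hC2 : ∀ p ∈ s, hsSq e (C p) ≠ ∞ := fun p hp =>
    ((hsSq_integral_le e (hA p hp)).trans_lt (hA2 p hp).lt_top).ne
  have hmean : ∫ ω', ∑ p ∈ s, a p • A p ω' ∂P = ∑ p ∈ s, a p • C p := by
    rw [integral_finsetSum (f := fun p ω => a p • A p ω) _ fun p hp => (hA p hp).smul (a p)]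
    exact Finset.sum_congr rfl fun p _ => integral_smul _ _
  have hdiff : ∀ ω j, ((∑ p ∈ s, a p • A p ω) - ∑ p ∈ s, a p • C p) (e j)
      = ∑ p ∈ s, a p • (A p ω (e j) - C p (e j)) := fun ω j => by
    simp [smul_sub]
  have hcen : ∀ p ∈ s, ∀ j, MemLp (fun ω => A p ω (e j) - C p (e j)) 2 P := fun p hp j =>
    (hL2 p hp j).sub (memLp_const _)
  -- `v j` is the variance of the `j`-th coordinate, expanded sesquilinearly in `H`; summing over
  -- `j` afterwards recovers the Hilbert–Schmidt covariances.
  set v : ι → ℂ := fun j => ∑ p ∈ s, ∑ q ∈ s, (starRingEnd ℂ (a p) * a q) *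
    ((∫ ω, inner ℂ (A p ω (e j)) (A q ω (e j)) ∂P) - inner ℂ (C p (e j)) (C q (e j))) with hv
  have hvar : ∀ j, ∫ ω, ‖∑ p ∈ s, a p • (A p ω (e j) - C p (e j))‖ ^ 2 ∂P = (v j).re := by
    intro j
    have hexp : ∀ ω, ((‖∑ p ∈ s, a p • (A p ω (e j) - C p (e j))‖ ^ 2 : ℝ) : ℂ)
        = ∑ p ∈ s, ∑ q ∈ s, (starRingEnd ℂ (a p) * a q) *
          inner ℂ (A p ω (e j) - C p (e j)) (A q ω (e j) - C q (e j)) := fun ω => by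
      have h0 : ∀ x : H, ((‖x‖ ^ 2 : ℝ) : ℂ) = inner ℂ x x := fun x => by
        rw [inner_self_eq_norm_sq_to_K]
        simp
      rw [h0, sum_inner]
      refine Finset.sum_congr rfl fun p _ => ?_
      rw [inner_sum]
      refine Finset.sum_congr rfl fun q _ => ?_
      rw [inner_smul_left, inner_smul_right, mul_assoc]
    have hint : ∀ p ∈ s, ∀ q ∈ s, Integrable (fun ω => (starRingEnd ℂ (a p) * a q) *
        inner ℂ (A p ω (e j) - C p (e j)) (A q ω (e j) - C q (e j))) P := fun p hp q hq =>
      (integrable_inner_of_memLp_two (hcen p hp j) (hcen q hq j)).const_mul _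
    rw [← Complex.ofReal_re (∫ ω, _ ∂P), ← integral_complex_ofReal]
    congr 1
    simp_rw [hexp]
    rw [integral_finsetSum _ fun p hp => integrable_finsetSum _ (hint p hp)]
    refine Finset.sum_congr rfl fun p hp => ?_
    rw [integral_finsetSum _ (hint p hp)]
    refine Finset.sum_congr rfl fun q hq => ?_
    rw [integral_const_mul, hCj p hp, hCj q hq,
      integral_inner_sub_integral (hL2 p hp j) (hL2 q hq j)]
  have hsum : HasSum v (∑ p ∈ s, ∑ q ∈ s, (starRingEnd ℂ (a p) * a q) *
      ((∫ ω, hsInner e (A p ω) (A q ω) ∂P) - hsInner e (C p) (C q))) :=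
    hasSum_sum fun p hp => hasSum_sum fun q hq =>
      ((hasSum_integral_hsInner e (hA p hp).1 (hA q hq).1 (hA2 p hp) (hA2 q hq)).sub
        (hasSum_hsInner e (hC2 p hp) (hC2 q hq))).mul_left _
  have hmem : ∀ j, MemLp (fun ω => ∑ p ∈ s, a p • (A p ω (e j) - C p (e j))) 2 P := fun j =>
    memLp_finsetSum _ fun p hp => (hcen p hp j).const_smul (a p)
  rw [hmean]
  calc ∫⁻ ω, hsSq e ((∑ p ∈ s, a p • A p ω) - ∑ p ∈ s, a p • C p) ∂P
      = ∑' j, ∫⁻ ω, ‖∑ p ∈ s, a p • (A p ω (e j) - C p (e j))‖ₑ ^ 2 ∂P := by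
        unfold hsSq
        simp_rw [hdiff]
        exact lintegral_tsum fun j => (hmem j).1.enorm.pow_const 2
    _ = ∑' j, ENNReal.ofReal (v j).re := by
        refine tsum_congr fun j => ?_
        rw [← hvar, ofReal_integral_eq_lintegral_ofReal (hmem j).integrable_norm_pow'
          (Eventually.of_forall fun _ => by positivity)]
        simp_rw [ENNReal.ofReal_pow (norm_nonneg _), ofReal_norm]
    _ = ENNReal.ofReal (∑' j, (v j).re) := by
        refine (ENNReal.ofReal_tsum_of_nonneg (fun j => ?_) (Complex.hasSum_re hsum).summable).symm
        rw [← hvar]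
        positivity
    _ ≤ ‖∑ p ∈ s, ∑ q ∈ s, (starRingEnd ℂ (a p) * a q) *
          ((∫ ω, hsInner e (A p ω) (A q ω) ∂P) - hsInner e (C p) (C q))‖ₑ := by
        rw [(Complex.hasSum_re hsum).tsum_eq, ← ofReal_norm]
        exact ENNReal.ofReal_le_ofReal (Complex.re_le_norm _)
    _ ≤ _ := by
        refine (enorm_sum_le _ _).trans (Finset.sum_le_sum fun p _ =>
          (enorm_sum_le _ _).trans (Finset.sum_le_sum fun q _ => ?_))
        rw [enorm_mul, enorm_mul, RCLike.enorm_conj]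

omit [CompleteSpace H] in
theorem integrable_outer {Y Z : Ω → H} (hY : MemLp Y 2 P) (hZ : MemLp Z 2 P) :
    Integrable (fun ω => outer (Y ω) (Z ω)) P := by
  have hm : AEStronglyMeasurable (fun ω => outer (Y ω) (Z ω)) P :=
    Continuous.comp_aestronglyMeasurable (g := fun p : H × H => outer p.1 p.2)
      (f := fun ω => (Y ω, Z ω)) continuous_outer (hY.1.prodMk hZ.1)
  have hn : Integrable (fun ω => ‖Y ω‖ * ‖Z ω‖) P := hY.norm.integrable_mul hZ.norm
  refine hn.mono' hm (Eventually.of_forall fun ω => ?_)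
  rw [norm_outer]

omit [CompleteSpace H] in
theorem lintegral_hsSq_outer_ne_top {Y Z : Ω → H} (hY : MemLp Y 4 P) (hZ : MemLp Z 4 P) :
    ∫⁻ ω, hsSq e (outer (Y ω) (Z ω)) ∂P ≠ ∞ := by
  have h4 : ∀ {W : Ω → H}, MemLp W 4 P → ∫⁻ ω, ‖W ω‖ₑ ^ 4 ∂P < ∞ := fun {W} hW => by
    have := (eLpNorm_lt_top_iff_lintegral_rpow_enorm_lt_top (by norm_num) (by norm_num)).1 hW.2
    simpa using this
  refine ((lintegral_mono fun ω => ?_).trans_lt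
    (b := ∫⁻ ω, ‖Y ω‖ₑ ^ 4 + ‖Z ω‖ₑ ^ 4 ∂P) ?_).ne
  · rw [hsSq_outer]
    rcases le_total ‖Y ω‖ₑ ‖Z ω‖ₑ with h | h
    · refine le_add_left ?_
      calc ‖Y ω‖ₑ ^ 2 * ‖Z ω‖ₑ ^ 2 ≤ ‖Z ω‖ₑ ^ 2 * ‖Z ω‖ₑ ^ 2 := by gcongr
        _ = ‖Z ω‖ₑ ^ 4 := by ring
    · refine le_add_right ?_
      calc ‖Y ω‖ₑ ^ 2 * ‖Z ω‖ₑ ^ 2 ≤ ‖Y ω‖ₑ ^ 2 * ‖Y ω‖ₑ ^ 2 := by gcongr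
        _ = ‖Y ω‖ₑ ^ 4 := by ring
  · rw [lintegral_add_left' (hY.1.enorm.pow_const 4)]
    exact ENNReal.add_lt_top.2 ⟨h4 hY, h4 hZ⟩

/-- The modulus of the trace of a cross-covariance operator is at most its trace norm. -/
theorem enorm_integral_inner_le_traceNorm [Countable ι] {Y Z : Ω → H}
    (hY : MemLp Y 2 P) (hZ : MemLp Z 2 P) :
    ‖∫ ω, inner ℂ (Z ω) (Y ω) ∂P‖ₑ ≤ traceNorm e (crossCov P Y Z) := by
  have hdiag : ∀ j, inner ℂ (e j) (crossCov P Y Z (e j)) =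
      ∫ ω, inner ℂ (Z ω) (e j) * inner ℂ (e j) (Y ω) ∂P := fun j => by
    have hint := integrable_outer hY hZ
    rw [crossCov, ContinuousLinearMap.integral_apply hint,
      ← integral_inner (hint.apply_continuousLinearMap (e j))]
    simp_rw [outer_apply, inner_smul_right]
  have hsum : HasSum (fun j => ∫ ω, inner ℂ (Z ω) (e j) * inner ℂ (e j) (Y ω) ∂P)
      (∫ ω, inner ℂ (Z ω) (Y ω) ∂P) := by
    refine hasSum_integral_of_lintegral_tsum_ne_top
      (fun j => (hZ.1.inner aestronglyMeasurable_const).mul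
        (aestronglyMeasurable_const.inner hY.1)) ?_
      (Eventually.of_forall fun ω => e.hasSum_inner_mul_inner _ _)
    -- Cauchy–Schwarz and Parseval bound the absolute series pointwise by `‖Z‖‖Y‖`, which is
    -- integrable.
    refine ((lintegral_mono fun ω => ?_).trans_lt (hZ.norm.integrable_mul hY.norm).2).ne
    simp only [enorm_mul, Pi.mul_apply, enorm_norm]
    refine (tsum_mul_le_sqrt_mul_sqrt _ _).trans_eq ?_
    have hsqrt : ∀ x : ℝ≥0∞, (x ^ 2) ^ (1 / 2 : ℝ) = x := fun x => by
      rw [← ENNReal.rpow_natCast, ← ENNReal.rpow_mul]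
      norm_num
    simp_rw [← inner_conj_symm (Z _) (e _), RCLike.enorm_conj, tsum_enorm_inner_sq, hsqrt]
  rw [← hsum.tsum_eq]
  simp_rw [← hdiag]
  exact enorm_tsum_le_tsum_enorm.trans (tsum_enorm_diag_le_traceNorm e _)

end RandomOperators

/-! ### Fourth-moment structure of the stationary real process. -/

section RandomFields

variable {Ω : Type*} [MeasurableSpace Ω] {P : Measure Ω} {H ι : Type*} [NormedAddCommGroup H]
  [InnerProductSpace ℂ H] {e : HilbertBasis ι ℂ H} {d : ℕ}
  {X : EuclideanSpace ℝ (Fin d) → Ω → H}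

theorem IsSecondOrderStationary.crossCov_eq (h : IsSecondOrderStationary P e X)
    (t s : EuclideanSpace ℝ (Fin d)) : crossCov P (X t) (X s) = statCov P X (t - s) := by
  simpa [statCov] using h.cov_shift (t - s) 0 s

theorem IsRealProcess.crossCov_conjH (h : IsRealProcess P e X) (t s : EuclideanSpace ℝ (Fin d)) :
    crossCov P (X t) (fun ω => conjH e (X s ω)) = crossCov P (X t) (X s) :=
  integral_congr_ae ((h s).mono fun ω hω => by
    simp only [hω])

/-- Bound on the covariance of two outer products of the process. -/
theorem enorm_cov_outer_le [CompleteSpace H] [Countable ι] (hreal : IsRealProcess P e X)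
    (hstat : IsSecondOrderStationary P e X) (t s w v : EuclideanSpace ℝ (Fin d)) :
    ‖(∫ ω, hsInner e (outer (X t ω) (X s ω)) (outer (X w ω) (X v ω)) ∂P) -
        hsInner e (∫ ω, outer (X t ω) (X s ω) ∂P) (∫ ω, outer (X w ω) (X v ω) ∂P)‖ₑ ≤
      ‖cum P e (X t) (X s) (X w) (X v)‖ₑ +
        traceNorm e (statCov P X (w - t)) * traceNorm e (statCov P X (s - v)) +
        traceNorm e (statCov P X (t - v)) * traceNorm e (statCov P X (w - s)) := by
  have h : (∫ ω, hsInner e (outer (X t ω) (X s ω)) (outer (X w ω) (X v ω)) ∂P) -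
        hsInner e (∫ ω, outer (X t ω) (X s ω) ∂P) (∫ ω, outer (X w ω) (X v ω) ∂P) =
      cum P e (X t) (X s) (X w) (X v) +
        (∫ ω, inner ℂ (X t ω) (X w ω) ∂P) * (∫ ω, inner ℂ (X v ω) (X s ω) ∂P) +
        hsInner e (statCov P X (t - v)) (statCov P X (w - s)) := by
    -- Reality replaces the pseudo-covariances in the cumulant by ordinary covariances, and
    -- stationarity then expresses them through lags.
    rw [cum, hreal.crossCov_conjH, hreal.crossCov_conjH, hstat.crossCov_eq t v,
      hstat.crossCov_eq w s]
    simp only [crossCov]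
    ring
  rw [h]
  refine (enorm_add_le _ _).trans (add_le_add ((enorm_add_le _ _).trans
    (add_le_add le_rfl ?_)) (enorm_hsInner_le e _ _))
  rw [enorm_mul, ← hstat.crossCov_eq, ← hstat.crossCov_eq]
  exact mul_le_mul' (enorm_integral_inner_le_traceNorm e (hstat.memLp_two _) (hstat.memLp_two _))
    (enorm_integral_inner_le_traceNorm e (hstat.memLp_two _) (hstat.memLp_two _))

end RandomFields

end SpectralVar

namespace SpectralVar

/-! ### Uniform bounds for Riemann sums. -/

section RiemannSums

variable {Ω : Type*} [MeasurableSpace Ω] {P : Measure Ω} {H ι : Type*} [NormedAddCommGroup H]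
  [InnerProductSpace ℂ H] [CompleteSpace H] {e : HilbertBasis ι ℂ H} {d : ℕ}

theorem norm_sub_le_of_mem_cell {𝕋 : Finset (EuclideanSpace ℝ (Fin d))} {δ : ℝ} (hδ : 0 ≤ δ)
    (h : mesh 𝕋 ≤ ENNReal.ofReal δ) {t x : EuclideanSpace ℝ (Fin d)} (ht : t ∈ 𝕋)
    (hx : x ∈ cell 𝕋 t) : ‖x - t‖ ≤ δ := by
  have := (edist_le_mesh 𝕋 ht hx).trans h
  rwa [edist_dist, ENNReal.ofReal_le_ofReal_iff hδ, dist_eq_norm] at this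

/-- Riemann sums of the trace norm of the covariance function over fine tessellations are
uniformly bounded. -/
theorem CovarianceCondition.exists_sum_le {C : EuclideanSpace ℝ (Fin d) → H →L[ℂ] H}
    (hC : CovarianceCondition e C) : ∃ I : ℝ≥0∞, I ≠ ∞ ∧ ∃ δ > (0 : ℝ),
      ∀ 𝕋 : Finset (EuclideanSpace ℝ (Fin d)), mesh 𝕋 ≤ ENNReal.ofReal δ → ∀ t,
        ∑ w ∈ 𝕋, volume (cell 𝕋 w) * traceNorm e (C (w - t)) ≤ I ∧
        ∑ w ∈ 𝕋, volume (cell 𝕋 w) * traceNorm e (C (t - w)) ≤ I := by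
  obtain ⟨γ, -, -, M, δ, hδ, hholder⟩ := hC.holder
  set osc : EuclideanSpace ℝ (Fin d) → ℝ≥0∞ := fun x =>
    ⨆ y, ⨆ (_ : ‖x - y‖ ≤ δ), traceNorm e (C y - C x) with hosc
  -- At `x`, this integrable majorant bounds the trace norm of `C` throughout the `δ`-ball around
  -- `x`. Only finiteness of the oscillation integral at the single scale `δ = δ₀` is needed, not
  -- the Hölder rate.
  set G : EuclideanSpace ℝ (Fin d) → ℝ≥0∞ := fun x => traceNorm e (C x) + osc x with hG
  have hGint : ∫⁻ x, G x ≠ ∞ := by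
    rw [hG, lintegral_add_left' hC.aemeasurable]
    exact (ENNReal.add_lt_top.2 ⟨hC.integrable,
      (hholder δ hδ le_rfl).trans_lt ENNReal.ofReal_lt_top⟩).ne
  have hle : ∀ x y, ‖x - y‖ ≤ δ → traceNorm e (C y) ≤ G x := fun x y hxy => by
    calc traceNorm e (C y) = traceNorm e (C x + (C y - C x)) := by rw [add_sub_cancel]
      _ ≤ traceNorm e (C x) + traceNorm e (C y - C x) := traceNorm_add_le e _ _
      _ ≤ G x := add_le_add le_rfl
        (le_iSup₂ (f := fun y (_ : ‖x - y‖ ≤ δ) => traceNorm e (C y - C x)) y hxy)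
  refine ⟨∫⁻ x, G x, hGint, δ, hδ, fun 𝕋 hmesh t => ⟨?_, ?_⟩⟩
  · rw [← lintegral_sub_right_eq_self G t]
    refine sum_volume_cell_mul_le 𝕋 fun w hw x hx => hle _ _ ?_
    simpa using norm_sub_le_of_mem_cell hδ.le hmesh hw hx
  · rw [← lintegral_sub_left_eq_self G t]
    refine sum_volume_cell_mul_le 𝕋 fun w hw x hx => hle _ _ ?_
    rw [sub_sub_sub_cancel_left, norm_sub_rev]
    exact norm_sub_le_of_mem_cell hδ.le hmesh hw hx

/-- Double Riemann sums of the fourth-order cumulants over fine tessellations are uniformly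
bounded. -/
theorem CumulantCondition.exists_sum_le {X : EuclideanSpace ℝ (Fin d) → Ω → H}
    (hV : CumulantCondition P e X) : ∃ J : ℝ≥0∞, J ≠ ∞ ∧ ∃ δ > (0 : ℝ),
      ∀ 𝕋 : Finset (EuclideanSpace ℝ (Fin d)), mesh 𝕋 ≤ ENNReal.ofReal δ → ∀ w v,
        ∑ t ∈ 𝕋, volume (cell 𝕋 t) * ∑ s ∈ 𝕋, volume (cell 𝕋 s) *
          ‖cum P e (X t) (X s) (X w) (X v)‖ₑ ≤ J := by
  obtain ⟨δ, hδ, hJ⟩ := hV.cum_integrable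
  set F : EuclideanSpace ℝ (Fin d) → EuclideanSpace ℝ (Fin d) → EuclideanSpace ℝ (Fin d) → ℝ≥0∞ :=
    fun w u v =>
      ⨆ l₁ ∈ Metric.ball (0 : EuclideanSpace ℝ (Fin d)) δ,
      ⨆ l₂ ∈ Metric.ball (0 : EuclideanSpace ℝ (Fin d)) δ,
      ⨆ l₃ ∈ Metric.ball (0 : EuclideanSpace ℝ (Fin d)) δ,
        ‖cum P e (X (l₁ + u)) (X (l₂ + v)) (X (l₃ + w)) (X 0)‖ₑ with hF
  refine ⟨_, hJ.ne, δ / 2, half_pos hδ, fun 𝕋 hmesh w v => ?_⟩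
  have hball : ∀ t ∈ 𝕋, ∀ x ∈ cell 𝕋 t, t - x ∈ Metric.ball 0 δ := fun t ht x hx => by
    rw [mem_ball_zero_iff, norm_sub_rev]
    linarith [norm_sub_le_of_mem_cell (half_pos hδ).le hmesh ht hx]
  have hle : ∀ t ∈ 𝕋, ∀ x ∈ cell 𝕋 t, ∀ s ∈ 𝕋, ∀ y ∈ cell 𝕋 s,
      ‖cum P e (X t) (X s) (X w) (X v)‖ₑ ≤ F (w - v) (x - v) (y - v) := by
    intro t ht x hx s hs y hy
    have hshift := hV.cum_shift (t - v) (s - v) (w - v) 0 v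
    simp only [sub_add_cancel, zero_add] at hshift
    -- After a shift moving `v` to the origin, the perturbations are `t - x` and `s - y`, from
    -- sampling points to points of their cells. The third is zero because `w` is not averaged over
    -- a cell.
    refine le_trans ?_ (le_iSup₂_of_le (t - x) (hball t ht x hx)
      (le_iSup₂_of_le (s - y) (hball s hs y hy)
        (le_iSup₂ (f := fun l₃ (_ : l₃ ∈ Metric.ball (0 : EuclideanSpace ℝ (Fin d)) δ) =>
          ‖cum P e (X (t - x + (x - v))) (X (s - y + (y - v))) (X (l₃ + (w - v))) (X 0)‖ₑ)
          0 (Metric.mem_ball_self hδ))))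
    simp only [sub_add_sub_cancel, zero_add, hshift, le_refl]
  calc ∑ t ∈ 𝕋, volume (cell 𝕋 t) * ∑ s ∈ 𝕋, volume (cell 𝕋 s) *
          ‖cum P e (X t) (X s) (X w) (X v)‖ₑ ≤ ∫⁻ x, ∫⁻ y, F (w - v) (x - v) y := by
        refine sum_volume_cell_mul_le 𝕋 (G := fun x => ∫⁻ y, F (w - v) (x - v) y)
          fun t ht x hx => ?_
        rw [← lintegral_sub_right_eq_self _ v]
        exact sum_volume_cell_mul_le 𝕋 fun s hs y hy => hle t ht x hx s hs y hy
    _ = ∫⁻ x, ∫⁻ y, F (w - v) x y :=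
        lintegral_sub_right_eq_self (fun x => ∫⁻ y, F (w - v) x y) v
    _ ≤ _ := le_iSup (fun w => ∫⁻ u, ∫⁻ v, F w u v) (w - v)

/-- The total volume of the cells whose sampling points are close to a given point. -/
theorem sum_volume_cell_ite_le {𝕋 : Finset (EuclideanSpace ℝ (Fin d))} {r m : ℝ} (hr : 0 ≤ r)
    (hm : 0 ≤ m) (hmesh : mesh 𝕋 ≤ ENNReal.ofReal m) (t : EuclideanSpace ℝ (Fin d)) :
    ∑ s ∈ 𝕋, volume (cell 𝕋 s) * (if ‖t - s‖ ≤ r then 1 else 0) ≤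
      ENNReal.ofReal ((r + m) ^ d) *
        volume (Metric.ball (0 : EuclideanSpace ℝ (Fin d)) 1) := by
  have h1 := Measure.addHaar_closedBall volume t (add_nonneg hr hm)
  rw [finrank_euclideanSpace, Fintype.card_fin] at h1
  rw [← h1, ← lintegral_indicator_one Metric.isClosed_closedBall.measurableSet]
  refine sum_volume_cell_mul_le 𝕋 (g := fun s => if ‖t - s‖ ≤ r then 1 else 0)
    fun s hs x hx => ?_
  split_ifs with h
  · have hx' : x ∈ Metric.closedBall t (r + m) := by
      rw [Metric.mem_closedBall, dist_eq_norm]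
      calc ‖x - t‖ = ‖(x - s) - (t - s)‖ := by rw [sub_sub_sub_cancel_right]
        _ ≤ ‖x - s‖ + ‖t - s‖ := norm_sub_le _ _
        _ ≤ r + m := by linarith [norm_sub_le_of_mem_cell hm hmesh hs hx]
    simp [Set.indicator_of_mem hx']
  · exact zero_le

end RiemannSums

/-- Weighted quadruple sums with the product and cumulant structure of the fourth moments. -/
theorem sum_sum_weights_mul_le {α : Type*} (s : Finset α) {m : α → ℝ≥0∞} {k ρ : α → α → ℝ≥0∞}
    {c : α → α → α → α → ℝ≥0∞} {V L I J : ℝ≥0∞} (hk1 : ∀ t u, k t u ≤ 1)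
    (hV : ∑ t ∈ s, m t ≤ V) (hL : ∀ t, ∑ u ∈ s, m u * k t u ≤ L)
    (hI : ∀ t, ∑ w ∈ s, m w * ρ w t ≤ I) (hI' : ∀ t, ∑ w ∈ s, m w * ρ t w ≤ I)
    (hJ : ∀ w v, ∑ t ∈ s, m t * ∑ u ∈ s, m u * c t u w v ≤ J) :
    ∑ p ∈ s ×ˢ s, ∑ q ∈ s ×ˢ s, (m p.1 * m p.2 * k p.1 p.2) * (m q.1 * m q.2 * k q.1 q.2) *
      (c p.1 p.2 q.1 q.2 + ρ q.1 p.1 * ρ p.2 q.2 + ρ p.1 q.2 * ρ q.1 p.2) ≤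
      V * L * (J + I * I + I * I) := by
  have hle : ∀ p : α × α, m p.1 * m p.2 * k p.1 p.2 ≤ m p.1 * m p.2 := fun p =>
    mul_le_of_le_one_right' (hk1 _ _)
  -- The proximity weight `k` is kept for only one of the two pairs, where it yields the factor `L`;
  -- for the other it is bounded by one.
  have hpairs : ∑ p ∈ s ×ˢ s, m p.1 * m p.2 * k p.1 p.2 ≤ V * L := by
    rw [Finset.sum_product]
    simp_rw [mul_assoc, ← Finset.mul_sum]
    calc _ ≤ ∑ t ∈ s, m t * L := Finset.sum_le_sum fun t _ => mul_le_mul_right (hL t) _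
      _ ≤ V * L := by rw [← Finset.sum_mul]; exact mul_le_mul_left hV _
  have hprod : ∀ f g : α → ℝ≥0∞, ∑ w ∈ s, m w * f w ≤ I → ∑ v ∈ s, m v * g v ≤ I →
      ∑ q ∈ s ×ˢ s, (m q.1 * m q.2 * k q.1 q.2) * (f q.1 * g q.2) ≤ I * I := by
    intro f g hf hg
    calc _ ≤ ∑ q ∈ s ×ˢ s, (m q.1 * f q.1) * (m q.2 * g q.2) := by
          refine Finset.sum_le_sum fun q _ => (mul_le_mul_left (hle q) _).trans_eq ?_
          ring
      _ = (∑ w ∈ s, m w * f w) * ∑ v ∈ s, m v * g v := by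
          rw [Finset.sum_mul_sum, Finset.sum_product]
      _ ≤ I * I := mul_le_mul' hf hg
  have hcum : ∀ q : α × α, ∑ p ∈ s ×ˢ s, (m p.1 * m p.2 * k p.1 p.2) * c p.1 p.2 q.1 q.2 ≤ J := by
    intro q
    refine le_trans ?_ (hJ q.1 q.2)
    rw [Finset.sum_product]
    refine Finset.sum_le_sum fun t _ => ?_
    rw [Finset.mul_sum]
    refine Finset.sum_le_sum fun u _ => (mul_le_mul_left (hle (t, u)) _).trans_eq ?_
    ring
  simp_rw [mul_add, Finset.sum_add_distrib]
  refine add_le_add (add_le_add ?_ ?_) ?_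
  -- For cumulants the roles are swapped: `q` is held fixed and `p` is summed freely.
  · rw [Finset.sum_comm]
    calc _ = ∑ q ∈ s ×ˢ s, (m q.1 * m q.2 * k q.1 q.2) *
          ∑ p ∈ s ×ˢ s, (m p.1 * m p.2 * k p.1 p.2) * c p.1 p.2 q.1 q.2 := by
          simp_rw [Finset.mul_sum]
          exact Finset.sum_congr rfl fun _ _ => Finset.sum_congr rfl fun _ _ => by ring
      _ ≤ ∑ q ∈ s ×ˢ s, (m q.1 * m q.2 * k q.1 q.2) * J :=
          Finset.sum_le_sum fun q _ => mul_le_mul_right (hcum q) _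
      _ ≤ V * L * J := by rw [← Finset.sum_mul]; exact mul_le_mul_left hpairs _
  · simp_rw [mul_assoc (_ * k _ _), ← Finset.mul_sum]
    calc _ ≤ ∑ p ∈ s ×ˢ s, (m p.1 * m p.2 * k p.1 p.2) * (I * I) :=
          Finset.sum_le_sum fun p _ => mul_le_mul_right
            (hprod (fun w => ρ w p.1) (fun v => ρ p.2 v) (hI _) (hI' _)) _
      _ ≤ V * L * (I * I) := by rw [← Finset.sum_mul]; exact mul_le_mul_left hpairs _
  · simp_rw [mul_assoc (_ * k _ _), ← Finset.mul_sum]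
    calc _ ≤ ∑ p ∈ s ×ˢ s, (m p.1 * m p.2 * k p.1 p.2) * (I * I) :=
          Finset.sum_le_sum fun p _ => mul_le_mul_right (by
            simp_rw [mul_comm (ρ p.1 _)]
            exact hprod (fun w => ρ w p.2) (fun v => ρ p.1 v) (hI _) (hI' _)) _
      _ ≤ V * L * (I * I) := by rw [← Finset.sum_mul]; exact mul_le_mul_left hpairs _

/-! ### Coefficients of the estimator and the final bound. -/

section Estimator

variable {d : ℕ}

/-- The coefficient of `X t ⊗ X s` in the estimator. -/
noncomputable def estimatorCoeff (K : EuclideanSpace ℝ (Fin d) → ℝ)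
    (𝕋 : Finset (EuclideanSpace ℝ (Fin d))) (Δ : ℝ) (θ t s : EuclideanSpace ℝ (Fin d)) : ℂ :=
  ((1 / (2 * Real.pi) ^ d : ℝ) : ℂ) *
    (Complex.exp (Complex.I * ((inner ℝ (t - s) θ : ℝ) : ℂ)) *
      ((K (Δ⁻¹ • (t - s)) * volume.real (cell 𝕋 t) * volume.real (cell 𝕋 s) /
        volume.real (region 𝕋 ∩ (fun x => x - (t - s)) '' region 𝕋) : ℝ) : ℂ))

theorem estimator_eq_sum {Ω H : Type*} [NormedAddCommGroup H] [InnerProductSpace ℂ H]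
    (X : EuclideanSpace ℝ (Fin d) → Ω → H) (K : EuclideanSpace ℝ (Fin d) → ℝ)
    (𝕋 : Finset (EuclideanSpace ℝ (Fin d))) (Δ : ℝ) (θ : EuclideanSpace ℝ (Fin d)) (ω : Ω) :
    estimator X K 𝕋 Δ θ ω =
      ∑ p ∈ 𝕋 ×ˢ 𝕋, estimatorCoeff K 𝕋 Δ θ p.1 p.2 • outer (X p.1 ω) (X p.2 ω) := by
  rw [estimator, Finset.sum_product, Finset.smul_sum]
  refine Finset.sum_congr rfl fun t _ => ?_
  rw [Finset.smul_sum]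
  refine Finset.sum_congr rfl fun s _ => ?_
  rw [smul_smul, estimatorCoeff]

/-- The phase has modulus one and `K ≤ 1`, so only the overlap volume in the denominator matters.
Its lower bound is needed only at lags up to `RΔ`, beyond which the kernel vanishes. -/
theorem enorm_estimatorCoeff_le {K : EuclideanSpace ℝ (Fin d) → ℝ} (hK : KernelCondition K)
    {R : ℝ} (hR : kernelSupport K ⊆ Metric.closedBall 0 R)
    {𝕋 : Finset (EuclideanSpace ℝ (Fin d))} {Δ b : ℝ} (hΔ : 0 < Δ) (hb : 0 < b)
    (hinter : ∀ h : EuclideanSpace ℝ (Fin d), ‖h‖ ≤ R * Δ →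
      b ≤ volume.real (region 𝕋 ∩ (fun x => x - h) '' region 𝕋))
    (θ t s : EuclideanSpace ℝ (Fin d)) :
    ‖estimatorCoeff K 𝕋 Δ θ t s‖ₑ ≤ ENNReal.ofReal b⁻¹ *
      (volume (cell 𝕋 t) * volume (cell 𝕋 s) * (if ‖t - s‖ ≤ R * Δ then 1 else 0)) := by
  split_ifs with h
  · have hpi : ‖((1 / (2 * Real.pi) ^ d : ℝ) : ℂ)‖ ≤ 1 := by
      rw [Complex.norm_real, Real.norm_of_nonneg (by positivity)]
      refine div_le_one_of_le₀ (one_le_pow₀ ?_) (by positivity)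
      linarith [Real.pi_gt_three]
    have hexp : ‖Complex.exp (Complex.I * ((inner ℝ (t - s) θ : ℝ) : ℂ))‖ = 1 := by
      rw [mul_comm, Complex.norm_exp_ofReal_mul_I]
    have hfrac : ‖((K (Δ⁻¹ • (t - s)) * volume.real (cell 𝕋 t) * volume.real (cell 𝕋 s) /
        volume.real (region 𝕋 ∩ (fun x => x - (t - s)) '' region 𝕋) : ℝ) : ℂ)‖ ≤
        b⁻¹ * (volume.real (cell 𝕋 t) * volume.real (cell 𝕋 s)) := by
      have hv := hinter _ h
      have hK0 := hK.nonneg (Δ⁻¹ • (t - s))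
      have hK1 := hK.le_one (Δ⁻¹ • (t - s))
      rw [Complex.norm_real, Real.norm_of_nonneg (by positivity), inv_mul_eq_div]
      gcongr
      exact mul_le_of_le_one_left measureReal_nonneg hK1
    have hnorm : ‖estimatorCoeff K 𝕋 Δ θ t s‖ ≤
        b⁻¹ * (volume.real (cell 𝕋 t) * volume.real (cell 𝕋 s)) := by
      rw [estimatorCoeff, norm_mul, norm_mul, hexp, one_mul]
      exact (mul_le_of_le_one_left (norm_nonneg _) hpi).trans hfrac
    rw [mul_one, ← ofReal_norm, ← ofReal_measureReal (volume_cell_ne_top 𝕋 t),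
      ← ofReal_measureReal (volume_cell_ne_top 𝕋 s), ← ENNReal.ofReal_mul measureReal_nonneg,
      ← ENNReal.ofReal_mul (by positivity)]
    exact ENNReal.ofReal_le_ofReal hnorm
  · have hK0 : K (Δ⁻¹ • (t - s)) = 0 := by
      by_contra hne
      have := hR (show Δ⁻¹ • (t - s) ∈ kernelSupport K from (hK.nonneg _).lt_of_ne' hne)
      rw [mem_closedBall_zero_iff, norm_smul, norm_inv, Real.norm_of_nonneg hΔ.le,
        inv_mul_le_iff₀ hΔ, mul_comm] at this
      exact h this
    simp [estimatorCoeff, hK0]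

end Estimator

end SpectralVar

open SpectralVar in
theorem mainTheorem6 {Ω H ι : Type*} [MeasurableSpace Ω] (P : Measure Ω) [IsProbabilityMeasure P]
    [NormedAddCommGroup H] [InnerProductSpace ℂ H] [CompleteSpace H]
    [TopologicalSpace.SeparableSpace H] (e : HilbertBasis ι ℂ H) {d : ℕ}
    (X : EuclideanSpace ℝ (Fin d) → Ω → H)
    (hreal : SpectralVar.IsRealProcess P e X)
    (hstat : SpectralVar.IsSecondOrderStationary P e X)
    (hC : SpectralVar.CovarianceCondition e (SpectralVar.statCov P X))
    (K : EuclideanSpace ℝ (Fin d) → ℝ) (hK : SpectralVar.KernelCondition K)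
    (𝕋 : ℕ → Finset (EuclideanSpace ℝ (Fin d))) (hS : SpectralVar.SamplingCondition 𝕋)
    (hV : SpectralVar.CumulantCondition P e X)
    (Δ : ℕ → ℝ) (hΔpos : ∀ n, 0 < Δ n)
    (hΔmesh : ∃ c : ℝ, ∀ᶠ n in atTop, SpectralVar.mesh (𝕋 n) ≤ ENNReal.ofReal (c * Δ n))
    (hΔsub : ∀ᶠ n in atTop, Δ n • SpectralVar.kernelSupport K ⊆
      SpectralVar.region (𝕋 n) - SpectralVar.region (𝕋 n))
    (hΔvol : Tendsto (fun n => Δ n ^ d / volume.real (SpectralVar.region (𝕋 n))) atTop (𝓝 0))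
    (Θ : Set (EuclideanSpace ℝ (Fin d))) :
    ∃ M : ℝ, ∀ᶠ n in atTop,
      (⨆ θ ∈ Θ, SpectralVar.estimatorVariance P e X K (𝕋 n) (Δ n) θ) ≤
        ENNReal.ofReal (M * (Δ n ^ d / volume.real (SpectralVar.region (𝕋 n)))) := by
  have : Countable ι := countable_of_hilbertBasis e
  obtain ⟨c, hc⟩ := hΔmesh
  obtain ⟨I, hI, δ₁, hδ₁, hIsum⟩ := hC.exists_sum_le
  obtain ⟨J, hJ, δ₂, hδ₂, hJsum⟩ := hV.exists_sum_le
  obtain ⟨R, hRpos, hR⟩ := hK.support_bounded.subset_closedBall_lt 0 0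
  obtain ⟨b, hb, hinter⟩ := hS.exists_volume_inter_ge hΔpos hΔvol R
  set v₁ := volume.real (Metric.ball (0 : EuclideanSpace ℝ (Fin d)) 1) with hv₁
  set B : ℝ≥0∞ := J + I * I + I * I with hB
  have hBtop : B ≠ ∞ := by finiteness
  -- `b⁻¹ ^ 2` comes from the two coefficients, the middle factor from the volume of a ball of
  -- radius `RΔ` enlarged by the mesh, and `B` from the sums over the free pair. Taking `max c 0`
  -- keeps the radius nonnegative.
  refine ⟨b⁻¹ ^ 2 * ((R + max c 0) ^ d * v₁) * B.toReal, ?_⟩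
  filter_upwards [hc, hinter, hS.volume_tendsto.eventually_gt_atTop 0,
    hS.mesh_tendsto.eventually_le_const (ENNReal.ofReal_pos.2 hδ₁),
    hS.mesh_tendsto.eventually_le_const (ENNReal.ofReal_pos.2 hδ₂)] with n hn hbn hpos hm₁ hm₂
  set V := volume.real (region (𝕋 n)) with hVdef
  have hΔn := hΔpos n
  have hmesh : mesh (𝕋 n) ≤ ENNReal.ofReal (max c 0 * Δ n) :=
    hn.trans (ENNReal.ofReal_le_ofReal (by gcongr; exact le_max_left _ _))
  have hweights := sum_sum_weights_mul_le (𝕋 n) (m := fun t => volume (cell (𝕋 n) t))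
    (k := fun t s => if ‖t - s‖ ≤ R * Δ n then 1 else 0)
    (ρ := fun t s => traceNorm e (statCov P X (t - s)))
    (c := fun t s w v => ‖cum P e (X t) (X s) (X w) (X v)‖ₑ)
    (fun t s => by split_ifs <;> simp) (sum_volume_cell_le (𝕋 n))
    (sum_volume_cell_ite_le (by positivity) (by positivity) hmesh)
    (fun t => (hIsum _ hm₁ t).1) (fun t => (hIsum _ hm₁ t).2) (hJsum _ hm₂)
  refine iSup₂_le fun θ _ => ?_
  set a : EuclideanSpace ℝ (Fin d) × EuclideanSpace ℝ (Fin d) → ℂ :=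
    fun p => estimatorCoeff K (𝕋 n) (Δ n) θ p.1 p.2 with ha
  have hcoef : ∀ p, ‖a p‖ₑ ≤ _ := fun p =>
    enorm_estimatorCoeff_le hK hR hΔn (mul_pos hb hpos) hbn θ p.1 p.2
  calc estimatorVariance P e X K (𝕋 n) (Δ n) θ
      ≤ ∑ p ∈ 𝕋 n ×ˢ 𝕋 n, ∑ q ∈ 𝕋 n ×ˢ 𝕋 n, ‖a p‖ₑ * ‖a q‖ₑ *
          ‖(∫ ω, hsInner e (outer (X p.1 ω) (X p.2 ω)) (outer (X q.1 ω) (X q.2 ω)) ∂P) -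
            hsInner e (∫ ω, outer (X p.1 ω) (X p.2 ω) ∂P)
              (∫ ω, outer (X q.1 ω) (X q.2 ω) ∂P)‖ₑ := by
        unfold estimatorVariance
        simp_rw [hsNorm_sq, estimator_eq_sum]
        exact lintegral_hsSq_sub_integral_le e (𝕋 n ×ˢ 𝕋 n) a
          (A := fun p ω => outer (X p.1 ω) (X p.2 ω))
          (fun p _ => integrable_outer (hstat.memLp_two _) (hstat.memLp_two _))
          (fun p _ => lintegral_hsSq_outer_ne_top e (hV.memLp_four _) (hV.memLp_four _))
    _ ≤ _ := Finset.sum_le_sum fun p _ => Finset.sum_le_sum fun q _ =>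
        mul_le_mul' (mul_le_mul' (hcoef p) (hcoef q))
          (enorm_cov_outer_le hreal hstat p.1 p.2 q.1 q.2)
    _ = ENNReal.ofReal (b * V)⁻¹ ^ 2 * _ := by
        rw [Finset.mul_sum]
        refine Finset.sum_congr rfl fun p _ => ?_
        rw [Finset.mul_sum]
        refine Finset.sum_congr rfl fun q _ => ?_
        rw [sq, mul_mul_mul_comm, mul_assoc]
    _ ≤ ENNReal.ofReal (b * V)⁻¹ ^ 2 * _ := mul_le_mul_right hweights _
    _ = ENNReal.ofReal (b⁻¹ ^ 2 * ((R + max c 0) ^ d * v₁) * B.toReal * (Δ n ^ d / V)) := by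
        rw [show J + I * I + I * I = ENNReal.ofReal B.toReal from (ENNReal.ofReal_toReal hBtop).symm,
          ← ofReal_measureReal (isCompact_region (𝕋 n)).measure_ne_top,
          ← ofReal_measureReal (μ := volume) (s := Metric.ball (0 : EuclideanSpace ℝ (Fin d)) 1)
            measure_ball_lt_top.ne, ← hVdef, ← hv₁, ← ENNReal.ofReal_pow (by positivity),
          ← ENNReal.ofReal_mul (by positivity), ← ENNReal.ofReal_mul (by positivity),
          ← ENNReal.ofReal_mul (by positivity), ← ENNReal.ofReal_mul (by positivity),
          ← add_mul, mul_pow]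
        congr 1
        field_simp
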